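/- Let $a>0$ and let $\alpha$ be a finite Borel measure on $\mathbb R$ with $\alpha(\mathbb R)=a$ and $\int_{\mathbb R}\log(1+|x|)\,\alpha(dx)<\infty$ (that is, $\alpha\in\mathbb F_a$). Let $\mathcal D_\alpha$ be the law of the (functional) Dirichlet process with parameter $\alpha$: the law, on the space $\mathbb P$ of Borel probability measures on $\mathbb R$, under which for every finite measurable partition $C_1,\dots,C_n$ of $\mathbb R$ the vector $(\varphi(C_1),\dots,\varphi(C_n))$ has the Dirichlet distribution with parameter $(\alpha(C_1),\dots,\alpha(C_n))$. Let $\mu_\alpha$ be the law of the mean $\int x\,\varphi(dx)$ when $\varphi$ has law $\mathcal D_\alpha$. For $w\in\mathbb C$ put $\zeta(w;\alpha,I)=\int_{\mathbb R}\log(1+wx)\,\alpha(dx)$; all logarithms and powers are principal. For $c>0$ and $d\ge 0$ let $B(\cdot\,;c,d)$ be the beta distribution on $[0,1]$ with parameters $c,d$ if $d>0$, and the unit mass at $1$ if $d=0$. Then, for every $c>0$ and $t\in\mathbb R$: (i) if $c\le a$, $$\int_{\mathbb R}(1+itx)^{-c}\,\mu_\alpha(dx)=\int_{[0,1]}\exp\{-\zeta(iut;\alpha,I)\}\,B(du;c,a-c);$$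 (ii) if $c>a$, $$\int_{\mathbb R}(1+itx)^{-c}\,\mu_\alpha(dx)=\frac{\Gamma(c-a+1)\,\Gamma(a)}{2\pi i\,\Gamma(c)}\int_0^{(1+)}\exp\{-\zeta(iwt;\alpha,I)\}\,w^{c-1}(w-1)^{a-c-1}\,dw ,$$ where $\int_0^{(1+)}$ denotes the (absolutely convergent) integral along any piecewise $C^1$ loop that starts at $0$ below the segment $[0,1]$, goes once counterclockwise around $1$ and returns to $0$ above the segment, lies between its end points in $\{w:\operatorname{Re}w>0\}\setminus(0,1]$, and leaves and reaches $0$ with nonzero one-sided derivatives that are not tangent to the imaginary axis. -/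

import Mathlib

open MeasureTheory ProbabilityTheory Filter Topology

noncomputable section

namespace LauricellaIdentity

/-- `ζ(w; α, f) = ∫ log (1 + w f(x)) α(dx)`, with the principal logarithm. -/
def zeta (w : ℂ) (α : Measure ℝ) (f : ℝ → ℝ) : ℂ :=
  ∫ x, Complex.log (1 + w * (f x : ℂ)) ∂α

/-- The class `𝔽_a` of finite Borel measures `α` on the real line with total mass `a` and
`∫ log (1 + |x|) α(dx) < ∞`. -/
def massClass (a : ℝ) : Set (Measure ℝ) :=
  {α | IsFiniteMeasure α ∧ α Set.univ = ENNReal.ofReal a ∧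
    Integrable (fun x : ℝ => Real.log (1 + |x|)) α}

/-- The gamma distribution with shape `b` and scale `1`; for shape `0` it is the point mass
at `0`. -/
def gammaLaw (b : ℝ) : Measure ℝ :=
  if 0 < b then gammaMeasure b 1 else Measure.dirac 0

/-- The Dirichlet distribution with parameter `(b₁, …, bₙ)`, where `bⱼ ≥ 0` and `∑ bⱼ > 0`: the
law of `(Z₁ / ∑ Zᵢ, …, Zₙ / ∑ Zᵢ)` with independent `Zⱼ ~ Gamma(bⱼ, 1)`. If all `bⱼ` are positive,
then its first `n - 1` coordinates have the usual density
`Γ(∑ bⱼ) / ∏ Γ(bⱼ) * u₁ ^ (b₁ - 1) ⋯ (1 - u₁ - ⋯ - uₙ₋₁) ^ (bₙ - 1)` and the last one is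
one minus their sum; a coordinate with `bⱼ = 0` vanishes almost surely. -/
def dirichletLaw {n : ℕ} (b : Fin n → ℝ) : Measure (Fin n → ℝ) :=
  (Measure.pi fun j => gammaLaw (b j)).map fun z j => z j / ∑ i, z i

/-- `D` is the functional Dirichlet distribution `𝒟_α`, a law on the space of probability measures
on the real line (with the σ-algebra generated by the evaluations, which is the Borel σ-algebra of
the weak topology): under `D`, the values of the random probability measure on every finite
measurable partition `C₁, …, Cₙ` of the line are Dirichlet distributed with parameter
`(α C₁, …, α Cₙ)`. -/
def IsDirichletProcess (α : Measure ℝ) (D : Measure (ProbabilityMeasure ℝ)) : Prop :=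
  ∀ (n : ℕ) (C : Fin n → Set ℝ), (∀ j, MeasurableSet (C j)) →
    Pairwise (fun i j => Disjoint (C i) (C j)) → (⋃ j, C j) = Set.univ →
    D.map (fun (φ : ProbabilityMeasure ℝ) (j : Fin n) => (φ : Measure ℝ).real (C j)) =
      dirichletLaw fun j => α.real (C j)

/-- The law of the mean `φ(I) = ∫ x φ(dx)` when `φ` has law `D`; this is `μ_α` for `D = 𝒟_α`. -/
def meanLaw (D : Measure (ProbabilityMeasure ℝ)) : Measure ℝ :=
  D.map fun φ : ProbabilityMeasure ℝ => ∫ x, x ∂(φ : Measure ℝ)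

/-- The beta distribution `B(· ; c, d)`, with `B(· ; c, 0)` the point mass at `1`. -/
def betaLaw (c d : ℝ) : Measure ℝ :=
  if d = 0 then Measure.dirac 1 else betaMeasure c d

/-- `γ`, restricted to `[0, 1]`, is a path of integration for `∫_0^{(1+)}`: a piecewise continuously
differentiable loop that starts at `0` below the cut `[0, 1]`, goes once around `1`
counterclockwise and returns to `0` above the cut. Between its end points it lies in the open
right half-plane slit along `(0, 1]`, and it leaves and reaches `0` nontangentially to the imaginary
axis with nonzero speed. -/
structure IsLoopAroundOne (γ : ℝ → ℂ) : Prop where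
  piecewise : ∃ (n : ℕ) (p : ℕ → ℝ), p 0 = 0 ∧ p n = 1 ∧
    ∀ i < n, p i < p (i + 1) ∧ ContDiffOn ℝ 1 γ (Set.Icc (p i) (p (i + 1)))
  start : γ 0 = 0
  finish : γ 1 = 0
  mem_slit : ∀ s ∈ Set.Ioo (0 : ℝ) 1, 0 < (γ s).re ∧ ((γ s).re ≤ 1 → (γ s).im ≠ 0)
  starts_below : ∀ᶠ s in 𝓝[>] (0 : ℝ), (γ s).im < 0
  ends_above : ∀ᶠ s in 𝓝[<] (1 : ℝ), 0 < (γ s).im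
  start_dir : 0 < (derivWithin γ (Set.Icc 0 1) 0).re
  finish_dir : (derivWithin γ (Set.Icc 0 1) 1).re < 0

/-- The integrand of the contour integral `∫_γ F(w) dw`, pulled back to the parameter interval. -/
def pullback (F : ℂ → ℂ) (γ : ℝ → ℂ) (s : ℝ) : ℂ :=
  F (γ s) * deriv γ s

/-- The contour integral `∫_γ F(w) dw` along `γ : [0, 1] → ℂ`. -/
def contourIntegral (F : ℂ → ℂ) (γ : ℝ → ℂ) : ℂ :=
  ∫ s in (0 : ℝ)..1, pullback F γ s

/-- `exp(-ζ(iwt; α, I)) w^(c-1) (w-1)^(a-c-1)`, with principal powers. -/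
def loopIntegrand (a c t : ℝ) (α : Measure ℝ) (w : ℂ) : ℂ :=
  Complex.exp (-zeta (Complex.I * w * t) α id) * w ^ ((c : ℂ) - 1) *
    (w - 1) ^ ((a : ℂ) - (c : ℂ) - 1)

end LauricellaIdentity

end

namespace LauricellaIdentity

section

/-! ### Gamma distributions: exponential tilting and Laplace transforms -/

/-! The engine is the Markov–Krein identity of order `a`: ∫ (1 + iwtx)^(-a) μ_α(dx) = exp(-ζ(iwt; α,
I)). For a simple integrand the mean is a linear form in a Dirichlet vector. Tilting a product of
gamma laws by the exponential of a multiple of the sum S only rescales it, so S is independent of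
the normalized vector P, with Laplace transform (1 - z)^(-∑ bⱼ). Evaluating E exp(-∑ lⱼ Pⱼ S) by
integrating out S, or coordinate by coordinate, gives E (1 + ∑ lⱼ Pⱼ)^(-∑ bⱼ) = ∏ (1 + lⱼ)^(-bⱼ)
(`integral_cpow_dirichletLaw`). Dominated convergence extends this to integrands whose random mean
exists almost surely. For the identity function that existence comes from the same formula applied
to truncations of |x| (`IsDirichletProcess.ae_integrable_id`). Holomorphy then carries the identity
from real w to Re w > 0 (`IsDirichletProcess.integral_cpow_meanLaw`).

Passing from order a to order c is Euler's integral: integrating (1 + iwy)^(-a) against w^(c-1)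
(w-1)^(a-c-1) dw yields a constant times (1 + iy)^(-c). Along any path in a cone ‖w‖ ≤ K Re w this
is a differential equation in y (`integral_cpow_mul_eq_cpow_mul_integral`): the integral Φ satisfies
(1 + iy) Φ' = -ic Φ, since the relevant combination integrates an exact derivative with vanishing
boundary terms. The segment [0, 1] serves for c < a, and gives the beta law; for c > a the
singularity at 1 is not integrable and a loop replaces the segment. Fubini finishes both cases.

The constant for the loop is ∫ w^(c-1) (w-1)^(s-1) dw at s = a - c
(`IsLoopAroundOne.integral_kernel`). For 0 < s < 1 an explicit primitive and the jump of (w-1)^s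
across the cut give 2i sin(πs) times a beta integral; the reflection formula rewrites this with 1/Γ,
which is entire, and continuation in s reaches s = a - c < 0. -/

lemma isProbabilityMeasure_gammaLaw (b : ℝ) : IsProbabilityMeasure (gammaLaw b) := by
  unfold gammaLaw
  split_ifs with h
  · exact isProbabilityMeasure_gammaMeasure h one_pos
  · infer_instance

attribute [instance] isProbabilityMeasure_gammaLaw

lemma ae_nonneg_gammaLaw (b : ℝ) : ∀ᵐ z ∂gammaLaw b, 0 ≤ z := by
  unfold gammaLaw
  split_ifs with h
  · rw [ae_iff, gammaMeasure, withDensity_apply']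
    have : {z : ℝ | ¬ 0 ≤ z} = Set.Iio 0 := by ext; simp
    rw [this, lintegral_gammaPDF_of_nonpos le_rfl]
  · simp [ae_dirac_eq]

lemma ae_pos_gammaLaw {b : ℝ} (hb : 0 < b) : ∀ᵐ z ∂gammaLaw b, 0 < z := by
  have h0 : ∀ᵐ z ∂gammaLaw b, z ≠ 0 := by
    rw [gammaLaw, if_pos hb, gammaMeasure]
    exact (withDensity_absolutelyContinuous _ _).ae_le (Measure.ae_ne volume 0)
  filter_upwards [ae_nonneg_gammaLaw b, h0] with z h1 h2
  exact lt_of_le_of_ne h1 h2.symm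

/-- The pointwise form of the tilting identity: the power of r produced by dilating the density
cancels the Jacobian and r^(-b), leaving only the change in the exponential. -/
lemma mul_gammaPDF_mul {b r : ℝ} (hr : 0 < r) (y : ℝ) :
    ENNReal.ofReal (r ^ (-b)) * (ENNReal.ofReal r * gammaPDF b 1 (r * y)) =
      gammaPDF b 1 y * ENNReal.ofReal (Real.exp ((1 - r) * y)) := by
  rcases lt_or_ge y 0 with hy | hy
  · rw [gammaPDF_of_neg hy, gammaPDF_of_neg (mul_neg_of_pos_of_neg hr hy)]
    simp
  rw [gammaPDF_of_nonneg hy, gammaPDF_of_nonneg (by positivity), ← ENNReal.ofReal_mul (by positivity),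
    ← ENNReal.ofReal_mul (by positivity), ← ENNReal.ofReal_mul' (by positivity)]
  congr 1
  rw [Real.mul_rpow hr.le hy, Real.rpow_neg hr.le, Real.rpow_sub hr, Real.rpow_one,
    show -(1 * y) = (-(1 * (r * y))) - (1 - r) * y by ring, Real.exp_sub]
  have : r ^ b ≠ 0 := (Real.rpow_pos_of_pos hr b).ne'
  field_simp

/-- Tilting a gamma distribution is the same as rescaling it. -/
lemma withDensity_exp_gammaLaw {b r : ℝ} (hb : 0 ≤ b) (hr : 0 < r) :
    (gammaLaw b).withDensity (fun z => ENNReal.ofReal (Real.exp ((1 - r) * z))) =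
      ENNReal.ofReal (r ^ (-b)) • (gammaLaw b).map (fun z => r⁻¹ * z) := by
  rcases hb.eq_or_lt with rfl | hb
  · have h0 : gammaLaw 0 = Measure.dirac 0 := by simp [gammaLaw]
    ext s hs
    rw [h0, withDensity_apply _ hs, Measure.smul_apply, Measure.map_apply (by fun_prop) hs,
      Measure.dirac_apply' _ (hs.preimage (by fun_prop)), ← lintegral_indicator hs,
      lintegral_dirac' _ (by fun_prop (disch := assumption))]
    by_cases h : (0 : ℝ) ∈ s <;> simp [h]
  · ext s hs
    have hg : gammaLaw b = volume.withDensity (gammaPDF b 1) := by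
      rw [gammaLaw, if_pos hb, gammaMeasure]
    have hm : Measurable (gammaPDF b 1) := (measurable_gammaPDFReal b 1).ennreal_ofReal
    have hi : Measurable (fun z : ℝ => r⁻¹ * z) := by fun_prop
    rw [hg, ← withDensity_mul _ hm (by fun_prop), withDensity_apply _ hs, Measure.smul_apply,
      Measure.map_apply hi hs, withDensity_apply _ (hi hs), ← lintegral_indicator hs,
      ← lintegral_indicator (hi hs)]
    conv_rhs => rw [← Real.smul_map_volume_mul_left hr.ne']
    have hm' : Measurable fun y : ℝ =>
        ((fun z => r⁻¹ * z) ⁻¹' s).indicator (gammaPDF b 1) (r * y) :=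
      (hm.indicator (hi hs)).comp (measurable_const_mul r)
    rw [lintegral_smul_measure, lintegral_map (hm.indicator (hi hs)) (by fun_prop), smul_eq_mul,
      smul_eq_mul, abs_of_pos hr, ← lintegral_const_mul _ hm',
      ← lintegral_const_mul _ (hm'.const_mul _)]
    · refine lintegral_congr fun y => ?_
      have hmem : (r * y ∈ (fun z => r⁻¹ * z) ⁻¹' s) ↔ y ∈ s := by
        simp [inv_mul_cancel_left₀ hr.ne']
      by_cases h : y ∈ s
      · rw [Set.indicator_of_mem h, Set.indicator_of_mem (hmem.2 h), mul_gammaPDF_mul hr]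
        rfl
      · rw [Set.indicator_of_notMem h, Set.indicator_of_notMem (fun h' => h (hmem.1 h'))]
        simp

variable {n : ℕ}

lemma pi_withDensity_prod (μ : Fin n → Measure ℝ) [∀ j, IsProbabilityMeasure (μ j)]
    (f : ℝ → ENNReal) (hf : Measurable f) [∀ j, SigmaFinite ((μ j).withDensity f)] :
    (Measure.pi μ).withDensity (fun z => ∏ j, f (z j)) =
      Measure.pi fun j => (μ j).withDensity f := by
  refine (Measure.pi_eq fun s hs => ?_).symm
  rw [withDensity_apply _ (MeasurableSet.univ_pi hs), ← lintegral_indicator (MeasurableSet.univ_pi hs)]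
  have h1 : (fun z : Fin n → ℝ => (Set.pi Set.univ s).indicator (fun z => ∏ j, f (z j)) z) =
      fun z => ∏ j, (s j).indicator f (z j) := by
    ext z
    by_cases h : z ∈ Set.pi Set.univ s
    · rw [Set.indicator_of_mem h]
      exact Finset.prod_congr rfl fun j _ => (Set.indicator_of_mem (h j trivial) f).symm
    · rw [Set.indicator_of_notMem h]
      obtain ⟨j, hj⟩ : ∃ j, z j ∉ s j := by simpa [Set.mem_pi] using h
      exact (Finset.prod_eq_zero (Finset.mem_univ j) (Set.indicator_of_notMem hj f)).symm
  have hm : ∀ j, Measurable ((s j).indicator f) := fun j => hf.indicator (hs j)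
  rw [h1, lintegral_prod_eq_prod_lintegral_of_indepFun Finset.univ
    (fun j (z : Fin n → ℝ) => (s j).indicator f (z j))
    (iIndepFun_pi (fun j => (hm j).aemeasurable)) (fun j => (hm j).comp (measurable_pi_apply j))]
  refine Finset.prod_congr rfl fun j _ => ?_
  rw [withDensity_apply _ (hs j), ← lintegral_indicator (hs j),
    (measurePreserving_eval μ j).lintegral_comp (hm j)]

/-- Tilting a product of gamma distributions by the sum is the same as rescaling it. -/
lemma withDensity_exp_sum_pi_gammaLaw {b : Fin n → ℝ} (hb : ∀ j, 0 ≤ b j) {r : ℝ} (hr : 0 < r) :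
    (Measure.pi fun j => gammaLaw (b j)).withDensity
        (fun z => ENNReal.ofReal (Real.exp ((1 - r) * ∑ j, z j))) =
      ENNReal.ofReal (r ^ (-∑ j, b j)) •
        (Measure.pi fun j => gammaLaw (b j)).map (fun z j => r⁻¹ * z j) := by
  have hfin : ∀ j, IsFiniteMeasure ((gammaLaw (b j)).withDensity
      (fun z => ENNReal.ofReal (Real.exp ((1 - r) * z)))) := fun j => by
    rw [withDensity_exp_gammaLaw (hb j) hr]
    exact Measure.smul_finite _ ENNReal.ofReal_ne_top
  have h1 := pi_withDensity_prod (fun j => gammaLaw (b j))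
    (fun z => ENNReal.ofReal (Real.exp ((1 - r) * z))) (by fun_prop)
  have h2 : (fun z : Fin n → ℝ => ENNReal.ofReal (Real.exp ((1 - r) * ∑ j, z j))) =
      fun z => ∏ j, ENNReal.ofReal (Real.exp ((1 - r) * z j)) := by
    ext z
    rw [← ENNReal.ofReal_prod_of_nonneg (fun _ _ => (Real.exp_pos _).le), Finset.mul_sum,
      Real.exp_sum]
  rw [h2, h1]
  refine Measure.pi_eq fun s hs => ?_
  rw [Measure.smul_apply, Measure.map_apply (by fun_prop) (MeasurableSet.univ_pi hs)]
  have h3 : (fun (z : Fin n → ℝ) j => r⁻¹ * z j) ⁻¹' Set.pi Set.univ s =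
      Set.pi Set.univ fun j => (fun z => r⁻¹ * z) ⁻¹' s j := by
    ext z; simp [Set.mem_pi]
  rw [h3, Measure.pi_pi, smul_eq_mul, ← Finset.sum_neg_distrib, Real.rpow_sum_of_pos hr,
    ENNReal.ofReal_prod_of_nonneg (fun _ _ => (Real.rpow_pos_of_pos hr _).le),
    ← Finset.prod_mul_distrib]
  refine Finset.prod_congr rfl fun j _ => ?_
  rw [withDensity_exp_gammaLaw (hb j) hr, Measure.smul_apply, smul_eq_mul,
    Measure.map_apply (by fun_prop) (hs j)]

/-- Feeds the identity theorem for holomorphic functions: agreement near t₀ on the real line alone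
already accumulates at t₀. -/
lemma frequently_eq_of_eventually_ofReal {f g : ℂ → ℂ} {t₀ : ℝ}
    (h : ∀ᶠ t : ℝ in 𝓝 t₀, f t = g t) : ∃ᶠ z in 𝓝[≠] (t₀ : ℂ), f z = g z := by
  have ht : Tendsto (fun t : ℝ => (t : ℂ)) (𝓝[≠] t₀) (𝓝[≠] (t₀ : ℂ)) :=
    Complex.continuous_ofReal.continuousWithinAt.tendsto_nhdsWithin
      (fun t ht => by simpa using ht)
  exact ht.frequently (eventually_nhdsWithin_of_eventually_nhds h).frequently

/-- If the Laplace transform of a finite measure is `K (1 - t) ^ (-a)` on the real half-line, then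
it is given by the same formula on the half-plane. -/
lemma complexMGF_eq_of_mgf_eq {Ω : Type*} [MeasurableSpace Ω] {μ : Measure Ω} {X : Ω → ℝ}
    {a K : ℝ} (hint : ∀ t < 1, Integrable (fun ω => Real.exp (t * X ω)) μ)
    (h : ∀ t < 1, mgf X μ t = K * (1 - t) ^ (-a)) {z : ℂ} (hz : z.re < 1) :
    complexMGF X μ z = K * (1 - z) ^ (-(a : ℂ)) := by
  have hU : IsOpen {z : ℂ | z.re < 1} := isOpen_lt Complex.continuous_re continuous_const
  have hsub : Set.Iio (1 : ℝ) ⊆ interior (integrableExpSet X μ) :=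
    interior_maximal (fun t ht => hint t ht) isOpen_Iio
  have hf : AnalyticOnNhd ℂ (complexMGF X μ) {z : ℂ | z.re < 1} :=
    analyticOnNhd_complexMGF.mono fun z hz => hsub hz
  have hg : AnalyticOnNhd ℂ (fun z : ℂ => K * (1 - z) ^ (-(a : ℂ))) {z : ℂ | z.re < 1} := by
    refine DifferentiableOn.analyticOnNhd (fun z hz => ?_) hU
    have hs : 1 - z ∈ Complex.slitPlane := Or.inl (by simpa using hz)
    exact (((differentiableAt_const _).sub differentiableAt_id).cpow_const
      hs |>.const_mul _).differentiableWithinAt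
  refine hf.eqOn_of_preconnected_of_frequently_eq hg
    (convex_halfSpace_re_lt 1).isPreconnected (z₀ := ((0 : ℝ) : ℂ)) (by simp) ?_ hz
  refine frequently_eq_of_eventually_ofReal ?_
  filter_upwards [Iio_mem_nhds (zero_lt_one' ℝ)] with t ht
  rw [complexMGF_ofReal, h t ht, Complex.ofReal_mul,
    Complex.ofReal_cpow (sub_nonneg.2 (le_of_lt ht))]
  push_cast
  rfl

end

/-! ### Laplace transforms of gamma sums, independence, and the Dirichlet generating function -/

section

/-- Turns a statement about the mass that the tilted measure gives to `E` into both integrability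
and the value of the Laplace transform on `E`. -/
lemma mgf_restrict_of_withDensity {Ω : Type*} [MeasurableSpace Ω] {μ : Measure Ω}
    [IsFiniteMeasure μ] {X : Ω → ℝ} (hX : Measurable X) {E : Set Ω} (hE : MeasurableSet E) {t c : ℝ}
    (hc : 0 ≤ c)
    (h : μ.withDensity (fun ω => ENNReal.ofReal (Real.exp (t * X ω))) E =
      ENNReal.ofReal c * μ E) :
    Integrable (fun ω => Real.exp (t * X ω)) (μ.restrict E) ∧
      mgf X (μ.restrict E) t = μ.real E * c := by
  rw [withDensity_apply _ hE] at h
  have hm : AEStronglyMeasurable (fun ω => Real.exp (t * X ω)) (μ.restrict E) :=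
    (by fun_prop : Measurable fun ω => Real.exp (t * X ω)).aestronglyMeasurable
  have hpos : 0 ≤ᵐ[μ.restrict E] fun ω => Real.exp (t * X ω) :=
    Eventually.of_forall fun ω => (Real.exp_pos _).le
  constructor
  · rw [← lintegral_ofReal_ne_top_iff_integrable hm hpos, h]
    finiteness
  · rw [mgf, integral_eq_lintegral_of_nonneg_ae hpos hm, h, ENNReal.toReal_mul,
      ENNReal.toReal_ofReal hc, mul_comm]
    rfl

lemma complexMGF_gammaLaw {b : ℝ} (hb : 0 ≤ b) {z : ℂ} (hz : z.re < 1) :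
    complexMGF id (gammaLaw b) z = (1 - z) ^ (-(b : ℂ)) := by
  have key : ∀ t < 1, Integrable (fun ω => Real.exp (t * id ω)) (gammaLaw b) ∧
      mgf id (gammaLaw b) t = 1 * (1 - t) ^ (-b) := fun t ht => by
    have h := congrArg (fun ν => ν Set.univ) (withDensity_exp_gammaLaw hb (sub_pos.2 ht))
    simp only [sub_sub_cancel, Measure.smul_apply, smul_eq_mul] at h
    rw [Measure.map_apply (by fun_prop) MeasurableSet.univ] at h
    have := mgf_restrict_of_withDensity measurable_id MeasurableSet.univ
      (Real.rpow_nonneg (sub_pos.2 ht).le _) h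
    simpa using this
  have := complexMGF_eq_of_mgf_eq (fun t ht => (key t ht).1) (fun t ht => (key t ht).2) hz
  simpa using this

variable {n : ℕ}

/-- The Laplace transform of the sum of independent gamma variables, on a scale invariant set. -/
lemma complexMGF_sum_restrict {b : Fin n → ℝ} (hb : ∀ j, 0 ≤ b j) {E : Set (Fin n → ℝ)}
    (hE : MeasurableSet E) (hinv : ∀ r : ℝ, 0 < r → (fun (z : Fin n → ℝ) j => r * z j) ⁻¹' E = E)
    {z : ℂ} (hz : z.re < 1) :
    complexMGF (fun z => ∑ j, z j) ((Measure.pi fun j => gammaLaw (b j)).restrict E) z =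
      (Measure.pi fun j => gammaLaw (b j)).real E * (1 - z) ^ (-((∑ j, b j : ℝ) : ℂ)) := by
  have key := fun (t : ℝ) (ht : t < 1) => by
    have h := congrArg (fun ν => ν E) (withDensity_exp_sum_pi_gammaLaw hb (sub_pos.2 ht))
    simp only [sub_sub_cancel, Measure.smul_apply, smul_eq_mul] at h
    -- `E` is unchanged by the rescaling that the tilt amounts to, so its tilted mass is (1 - t)^(-∑
    -- bⱼ) times its original mass.
    rw [Measure.map_apply (by fun_prop) hE, hinv _ (inv_pos.2 (sub_pos.2 ht))] at h
    exact mgf_restrict_of_withDensity (by fun_prop) hE (Real.rpow_nonneg (sub_pos.2 ht).le _) h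
  exact complexMGF_eq_of_mgf_eq (fun t ht => (key t ht).1) (fun t ht => (key t ht).2) hz

/-- The normalized vector of independent gamma variables is independent of their sum. -/
lemma indepFun_normalize_sum {b : Fin n → ℝ} (hb : ∀ j, 0 ≤ b j) :
    IndepFun (fun (z : Fin n → ℝ) j => z j / ∑ i, z i) (fun z => ∑ i, z i)
      (Measure.pi fun j => gammaLaw (b j)) := by
  set μ := Measure.pi fun j => gammaLaw (b j) with hμ
  have hP : Measurable (fun (z : Fin n → ℝ) j => z j / ∑ i, z i) := by fun_prop
  have hS : Measurable (fun z : Fin n → ℝ => ∑ i, z i) := by fun_prop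
  rw [indepFun_iff_measure_inter_preimage_eq_mul]
  intro A B hA hB
  set E := (fun (z : Fin n → ℝ) j => z j / ∑ i, z i) ⁻¹' A with hE
  have hEm : MeasurableSet E := hP hA
  have hinv : ∀ r : ℝ, 0 < r → (fun (z : Fin n → ℝ) j => r * z j) ⁻¹' E = E := fun r hr => by
    rw [hE, ← Set.preimage_comp]
    congr 1
    ext z j
    simp only [Function.comp, ← Finset.mul_sum]
    exact mul_div_mul_left _ _ hr.ne'
  -- On the scale invariant event `E` the sum has the same transform as on the whole space, up to
  -- the factor μ(E). Equality of characteristic functions makes its law on `E` proportional to its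
  -- full law, which is independence.
  have h : (μ.restrict E).map (fun z => ∑ i, z i) = μ E • μ.map (fun z => ∑ i, z i) := by
    have : IsFiniteMeasure (μ E • μ.map (fun z => ∑ i, z i)) :=
      Measure.smul_finite _ (measure_ne_top _ _)
    refine Measure.ext_of_charFun ?_
    ext t
    have hz : ((t : ℂ) * Complex.I).re < 1 := by simp
    have h1 := complexMGF_sum_restrict hb hEm hinv hz
    have h2 := complexMGF_sum_restrict hb MeasurableSet.univ (fun _ _ => rfl) hz
    rw [Measure.restrict_univ, ← hμ, probReal_univ, Complex.ofReal_one, one_mul] at h2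
    rw [← hμ, ← h2] at h1
    rw [complexMGF_mul_I hS.aemeasurable, complexMGF_mul_I hS.aemeasurable] at h1
    rw [h1, charFun_apply, charFun_apply, integral_smul_measure]
    simp [measureReal_def]
  have h2 := congrArg (fun ν => ν B) h
  simp only [Measure.smul_apply, smul_eq_mul, Measure.map_apply hS hB] at h2
  rw [Measure.restrict_apply (hS hB)] at h2
  rw [Set.inter_comm, h2]

lemma integral_exp_neg_sum_pi_gammaLaw {b : Fin n → ℝ} (hb : ∀ j, 0 ≤ b j) {l : Fin n → ℂ}
    (hl : ∀ j, 0 ≤ (l j).re) :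
    ∫ z, Complex.exp (-∑ j, l j * z j) ∂(Measure.pi fun j => gammaLaw (b j)) =
      ∏ j, (1 + l j) ^ (-(b j : ℂ)) := by
  have h1 : (fun z : Fin n → ℝ => Complex.exp (-∑ j, l j * z j)) =
      fun z => ∏ j, Complex.exp (-l j * z j) := by
    ext z
    rw [← Complex.exp_sum, ← Finset.sum_neg_distrib]
    simp
  rw [h1, integral_fintype_prod_eq_prod (fun j (x : ℝ) => Complex.exp (-l j * x))]
  refine Finset.prod_congr rfl fun j _ => ?_
  have := complexMGF_gammaLaw (hb j) (z := -l j) (by rw [Complex.neg_re]; linarith [hl j])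
  simpa [complexMGF] using this

lemma ae_nonneg_pi_gammaLaw (b : Fin n → ℝ) :
    ∀ᵐ z ∂(Measure.pi fun j => gammaLaw (b j)), ∀ j, 0 ≤ z j := by
  rw [ae_all_iff]
  exact fun j => (measurePreserving_eval (fun j => gammaLaw (b j)) j).quasiMeasurePreserving.ae
    (ae_nonneg_gammaLaw (b j))

lemma ae_sum_pos_pi_gammaLaw {b : Fin n → ℝ} (hsum : 0 < ∑ j, b j) :
    ∀ᵐ z ∂(Measure.pi fun j => gammaLaw (b j)), 0 < ∑ j, z j := by
  obtain ⟨j, -, hj⟩ := Finset.exists_lt_of_sum_lt (s := Finset.univ) (f := fun _ => (0 : ℝ))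
    (g := b) (by simpa using hsum)
  filter_upwards [ae_nonneg_pi_gammaLaw b,
    (measurePreserving_eval (fun j => gammaLaw (b j)) j).quasiMeasurePreserving.ae
      (ae_pos_gammaLaw hj)] with z h1 h2
  exact Finset.sum_pos' (fun j _ => h1 j) ⟨j, Finset.mem_univ j, h2⟩

/-- The Lauricella type generating function of the Dirichlet distribution. -/
lemma integral_cpow_dirichletLaw {b : Fin n → ℝ} (hb : ∀ j, 0 ≤ b j) (hsum : 0 < ∑ j, b j)
    {l : Fin n → ℂ} (hl : ∀ j, 0 ≤ (l j).re) :
    ∫ p, (1 + ∑ j, l j * p j) ^ (-((∑ j, b j : ℝ) : ℂ)) ∂(dirichletLaw b) =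
      ∏ j, (1 + l j) ^ (-(b j : ℂ)) := by
  rw [← integral_exp_neg_sum_pi_gammaLaw hb hl]
  set μ := Measure.pi fun j => gammaLaw (b j) with hμ
  have hP : Measurable (fun (z : Fin n → ℝ) j => z j / ∑ i, z i) := by fun_prop
  have hS : Measurable (fun z : Fin n → ℝ => ∑ i, z i) := by fun_prop
  have hd : dirichletLaw b = μ.map (fun (z : Fin n → ℝ) j => z j / ∑ i, z i) := rfl
  have hind := (indepFun_iff_map_prod_eq_prod_map_map hP.aemeasurable hS.aemeasurable).1
    (indepFun_normalize_sum hb)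
  rw [← hμ, ← hd] at hind
  set F : (Fin n → ℝ) × ℝ → ℂ := fun q => Complex.exp (-∑ j, l j * q.1 j * q.2) with hF
  have hFm : Measurable F := by fun_prop
  -- Undoing the normalization divides by the sum, which is positive only almost surely.
  have hFae : (fun z : Fin n → ℝ => F (fun j => z j / ∑ i, z i, ∑ i, z i)) =ᵐ[μ]
      fun z => Complex.exp (-∑ j, l j * z j) := by
    filter_upwards [ae_sum_pos_pi_gammaLaw hsum] with z hz
    simp only [hF]
    congr 2
    refine Finset.sum_congr rfl fun j _ => ?_
    rw [mul_assoc, ← Complex.ofReal_mul, div_mul_cancel₀ _ hz.ne']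
  have hint : Integrable F ((dirichletLaw b).prod (μ.map fun z => ∑ i, z i)) := by
    rw [← hind, integrable_map_measure hFm.aestronglyMeasurable (hP.prodMk hS).aemeasurable]
    refine Integrable.congr ?_ hFae.symm
    refine Integrable.of_bound (by fun_prop : Measurable _).aestronglyMeasurable 1 ?_
    filter_upwards [ae_nonneg_pi_gammaLaw b] with z hz
    rw [Complex.norm_exp, Real.exp_le_one_iff, Complex.neg_re, Complex.re_sum, neg_nonpos]
    refine Finset.sum_nonneg fun j _ => ?_
    simpa using mul_nonneg (hl j) (hz j)
  have hpr : IsProbabilityMeasure (dirichletLaw b) := Measure.isProbabilityMeasure_map hP.aemeasurable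
  rw [← integral_congr_ae hFae, ← integral_map (f := F) (hP.prodMk hS).aemeasurable
    hFm.aestronglyMeasurable, hind, integral_prod _ hint]
  have hnn : ∀ᵐ p ∂(dirichletLaw b), ∀ j, 0 ≤ p j := by
    rw [hd, ae_map_iff hP.aemeasurable (by measurability)]
    filter_upwards [ae_nonneg_pi_gammaLaw b] with z hz j
    exact div_nonneg (hz j) (Finset.sum_nonneg fun j _ => hz j)
  refine integral_congr_ae ?_
  filter_upwards [hnn] with p hp
  have hz : (-∑ j, l j * p j).re < 1 := by
    rw [Complex.neg_re, Complex.re_sum, neg_lt]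
    refine lt_of_lt_of_le (by norm_num) (Finset.sum_nonneg fun j _ => ?_)
    simpa using mul_nonneg (hl j) (hp j)
  -- With `p` frozen, the inner integral is the Laplace transform of the sum at -∑ lⱼ pⱼ.
  have h2 := complexMGF_sum_restrict hb MeasurableSet.univ (fun _ _ => rfl) hz
  rw [Measure.restrict_univ, ← hμ, probReal_univ, Complex.ofReal_one, one_mul, sub_neg_eq_add] at h2
  rw [← h2, complexMGF, ← integral_map (μ := μ) (φ := fun z : Fin n → ℝ => ∑ i, z i)
    (f := fun s : ℝ => Complex.exp ((-∑ j, l j * p j) * s)) hS.aemeasurable (by fun_prop)]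
  simp only [hF, neg_mul, Finset.sum_mul]

end

section

/-! ### The generalized Stieltjes transform of Dirichlet means -/

lemma norm_cpow_neg_le_one {a : ℝ} (ha : 0 ≤ a) {z : ℂ} (hz : 0 ≤ z.re) :
    ‖(1 + z) ^ (-(a : ℂ))‖ ≤ 1 := by
  rw [← Complex.ofReal_neg, Complex.norm_cpow_real]
  refine Real.rpow_le_one_of_one_le_of_nonpos ?_ (by simpa using ha)
  calc (1 : ℝ) ≤ (1 + z).re := by simpa using hz
    _ ≤ ‖1 + z‖ := Complex.re_le_norm _

lemma continuousAt_cpow_one_add {z : ℂ} (hz : 0 ≤ z.re) (s : ℂ) :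
    ContinuousAt (fun z : ℂ => (1 + z) ^ s) z :=
  (continuousAt_const.add continuousAt_id).cpow continuousAt_const
    (Or.inl (by change 0 < (1 + z).re; rw [Complex.add_re, Complex.one_re]; linarith))

lemma norm_log_le_abs_log_add_pi (z : ℂ) : ‖Complex.log z‖ ≤ |Real.log ‖z‖| + Real.pi := by
  refine (Complex.norm_le_abs_re_add_abs_im _).trans ?_
  rw [Complex.log_re, Complex.log_im]
  gcongr
  exact Complex.abs_arg_le_pi z

lemma measurable_probabilityMeasure_real {s : Set ℝ} (hs : MeasurableSet s) :
    Measurable fun φ : ProbabilityMeasure ℝ => (φ : Measure ℝ).real s :=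
  ((Measure.measurable_coe hs).comp measurable_subtype_coe).ennreal_toReal

lemma stronglyMeasurable_probabilityMeasure_integral {f : ℝ → ℝ} (hf : Measurable f) :
    StronglyMeasurable fun φ : ProbabilityMeasure ℝ => ∫ x, f x ∂(φ : Measure ℝ) :=
  StronglyMeasurable.integral_kernel
    (κ := ⟨fun φ : ProbabilityMeasure ℝ => (φ : Measure ℝ), measurable_subtype_coe⟩)
    hf.stronglyMeasurable

lemma measurable_probabilityMeasure_lintegral {f : ℝ → ENNReal} (hf : Measurable f) :
    Measurable fun φ : ProbabilityMeasure ℝ => ∫⁻ x, f x ∂(φ : Measure ℝ) :=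
  (Measure.measurable_lintegral hf).comp measurable_subtype_coe

lemma integral_eq_sum_of_partition {E : Type*} [NormedAddCommGroup E] [NormedSpace ℝ E]
    [CompleteSpace E] {n : ℕ} {C : Fin n → Set ℝ} (hC : ∀ j, MeasurableSet (C j))
    (hdisj : Pairwise fun i j => Disjoint (C i) (C j)) (hcover : (⋃ j, C j) = Set.univ)
    (μ : Measure ℝ) [IsFiniteMeasure μ] {g : ℝ → E} {v : Fin n → E}
    (hg : ∀ j, ∀ x ∈ C j, g x = v j) :
    ∫ x, g x ∂μ = ∑ j, μ.real (C j) • v j := by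
  have hint : ∀ j, IntegrableOn g (C j) μ := fun j =>
    (integrableOn_const (C := v j)).congr_fun (fun x hx => (hg j x hx).symm) (hC j)
  rw [← setIntegral_univ, ← hcover, integral_iUnion_fintype hC hdisj hint]
  refine Finset.sum_congr rfl fun j _ => ?_
  rw [setIntegral_congr_fun (hC j) (hg j), setIntegral_const]

variable {a : ℝ} {α : Measure ℝ} {D : Measure (ProbabilityMeasure ℝ)}

/-- The one-cell partition already determines the total mass of `D`, because a Dirichlet law is the
image of a probability measure. -/
lemma IsDirichletProcess.isProbabilityMeasure (hD : IsDirichletProcess α D) :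
    IsProbabilityMeasure D := by
  have h := hD 1 (fun _ => Set.univ) (fun _ => MeasurableSet.univ)
    (fun i j hij => (hij (Subsingleton.elim i j)).elim) (Set.iUnion_const _)
  have hP : Measurable (fun (z : Fin 1 → ℝ) j => z j / ∑ i, z i) := by fun_prop
  have h2 : IsProbabilityMeasure (dirichletLaw fun _ : Fin 1 => α.real Set.univ) :=
    Measure.isProbabilityMeasure_map hP.aemeasurable
  rw [← h] at h2
  refine ⟨?_⟩
  have := h2.measure_univ
  rwa [Measure.map_apply (measurable_pi_lambda _ fun j =>
    measurable_probabilityMeasure_real MeasurableSet.univ) MeasurableSet.univ] at this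

/-- The Markov–Krein identity for simple functions. -/
lemma IsDirichletProcess.integral_cpow_simpleFunc (hD : IsDirichletProcess α D)
    [IsFiniteMeasure α] (ha : 0 < α.real Set.univ) (f : SimpleFunc ℝ ℝ) {z : ℂ}
    (hz : ∀ x, 0 ≤ (z * f x).re) :
    ∫ φ : ProbabilityMeasure ℝ, (1 + z * (∫ x, f x ∂(φ : Measure ℝ) : ℝ)) ^
        (-((α.real Set.univ : ℝ) : ℂ)) ∂D =
      Complex.exp (-∫ x, Complex.log (1 + z * f x) ∂α) := by
  set e := f.range.equivFin.symm with he
  set q : Fin f.range.card → ℝ := fun j => (e j : ℝ) with hq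
  set C : Fin f.range.card → Set ℝ := fun j => f ⁻¹' {q j} with hCdef
  have hC : ∀ j, MeasurableSet (C j) := fun j => f.measurableSet_fiber _
  have hdisj : Pairwise fun i j => Disjoint (C i) (C j) := fun i j hij => by
    refine Disjoint.preimage _ (Set.disjoint_singleton.2 fun h => hij ?_)
    exact e.injective (Subtype.ext h)
  have hcover : (⋃ j, C j) = Set.univ := by
    refine Set.eq_univ_of_forall fun x => Set.mem_iUnion.2 ⟨e.symm ⟨f x, f.mem_range_self x⟩, ?_⟩
    simp [hCdef, hq]
  have hqz : ∀ j, 0 ≤ (z * q j).re := fun j => by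
    obtain ⟨x, hx⟩ := SimpleFunc.mem_range.1 (e j).2
    rw [show q j = f x from hx.symm]
    exact hz x
  have hsum : ∑ j, α.real (C j) = α.real Set.univ := by
    rw [← hcover, measureReal_iUnion_fintype hdisj hC]
  have hmain := integral_cpow_dirichletLaw (b := fun j => α.real (C j)) (fun j => measureReal_nonneg)
    (by rw [hsum]; exact ha) hqz
  rw [← hD _ C hC hdisj hcover, integral_map] at hmain
  · rw [hsum] at hmain
    have h1 : ∀ φ : ProbabilityMeasure ℝ, z * (∫ x, f x ∂(φ : Measure ℝ) : ℝ) =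
        ∑ j, z * q j * (φ : Measure ℝ).real (C j) := fun φ => by
      rw [integral_eq_sum_of_partition hC hdisj hcover (φ : Measure ℝ) (v := q) fun j x hx => hx]
      push_cast [smul_eq_mul]
      rw [Finset.mul_sum]
      exact Finset.sum_congr rfl fun j _ => by ring
    simp only [h1, hmain]
    rw [integral_eq_sum_of_partition hC hdisj hcover α
      (v := fun j => Complex.log (1 + z * q j)) fun j x hx => by
        rw [show f x = q j from hx], ← Finset.sum_neg_distrib, Complex.exp_sum]
    refine Finset.prod_congr rfl fun j _ => ?_
    have hne : 1 + z * q j ≠ 0 := fun h => by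
      have := congrArg Complex.re h
      rw [Complex.add_re, Complex.one_re, Complex.zero_re] at this
      linarith [hqz j]
    rw [Complex.cpow_def_of_ne_zero hne, Complex.real_smul]
    ring_nf
  · exact (measurable_pi_lambda _ fun j => measurable_probabilityMeasure_real (hC j)).aemeasurable
  · exact (by fun_prop : Measurable _).aestronglyMeasurable

/-- A dominating function for the logarithms along simple approximations; the factor 2 is the one in
the bound for `SimpleFunc.approxOn`. -/
lemma norm_log_one_add_le {z : ℂ} {x y : ℝ} (hz : 0 ≤ (z * y).re) (hxy : |y| ≤ 2 * |x|) :
    ‖Complex.log (1 + z * y)‖ ≤ Real.log (1 + 2 * ‖z‖) + Real.log (1 + |x|) + Real.pi := by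
  refine (norm_log_le_abs_log_add_pi _).trans ?_
  gcongr
  have h1 : 1 ≤ ‖1 + z * y‖ := by
    calc (1 : ℝ) ≤ (1 + z * y).re := by rw [Complex.add_re, Complex.one_re]; linarith
      _ ≤ _ := Complex.re_le_norm _
  rw [abs_of_nonneg (Real.log_nonneg h1), ← Real.log_mul (by positivity) (by positivity)]
  refine Real.log_le_log (by linarith) ?_
  calc ‖1 + z * y‖ ≤ ‖(1 : ℂ)‖ + ‖z * y‖ := norm_add_le _ _
    _ = 1 + ‖z‖ * |y| := by simp
    _ ≤ 1 + ‖z‖ * (2 * |x|) := by gcongr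
    _ ≤ _ := by nlinarith [norm_nonneg z, abs_nonneg x]

/-- The Markov–Krein identity for functions whose mean exists almost surely. -/
lemma IsDirichletProcess.integral_cpow (hD : IsDirichletProcess α D)
    [IsFiniteMeasure α] (ha : 0 < α.real Set.univ) {f : ℝ → ℝ} (hf : Measurable f)
    (hlog : Integrable (fun x => Real.log (1 + |f x|)) α)
    (hmean : ∀ᵐ φ : ProbabilityMeasure ℝ ∂D, Integrable f (φ : Measure ℝ)) {z : ℂ}
    (hz : ∀ x, 0 ≤ (z * f x).re) :
    ∫ φ : ProbabilityMeasure ℝ, (1 + z * (∫ x, f x ∂(φ : Measure ℝ) : ℝ)) ^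
        (-((α.real Set.univ : ℝ) : ℂ)) ∂D =
      Complex.exp (-∫ x, Complex.log (1 + z * f x) ∂α) := by
  have hDp := hD.isProbabilityMeasure
  -- Approximating with values inside this set keeps Re(z F) ≥ 0 for the simple functions, as the
  -- previous identity requires.
  set s : Set ℝ := {q | 0 ≤ (z * q).re} with hs
  have h0 : (0 : ℝ) ∈ s := by simp [hs]
  set F : ℕ → SimpleFunc ℝ ℝ := SimpleFunc.approxOn f hf s 0 h0 with hF
  have hFz : ∀ k x, 0 ≤ (z * F k x).re := fun k x => SimpleFunc.approxOn_mem hf h0 k x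
  have hFb : ∀ k x, |F k x| ≤ 2 * |f x| := fun k x => by
    have := SimpleFunc.norm_approxOn_zero_le hf h0 x k
    rw [Real.norm_eq_abs, Real.norm_eq_abs] at this
    linarith
  have hFt : ∀ x, Tendsto (fun k => F k x) atTop (𝓝 (f x)) := fun x =>
    SimpleFunc.tendsto_approxOn hf h0 (subset_closure (hz x))
  have hre : ∀ {μ : Measure ℝ} (g : ℝ → ℝ), (∀ x, 0 ≤ (z * g x).re) → 0 ≤ (z * (∫ x, g x ∂μ : ℝ)).re := by
    intro μ g hg
    have : (z * (∫ x, g x ∂μ : ℝ)).re = ∫ x, (z * g x).re ∂μ := by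
      simp [integral_const_mul]
    rw [this]
    exact integral_nonneg hg
  have hL : Tendsto (fun k => ∫ φ : ProbabilityMeasure ℝ, (1 + z * (∫ x, F k x ∂(φ : Measure ℝ) : ℝ)) ^
        (-((α.real Set.univ : ℝ) : ℂ)) ∂D) atTop
      (𝓝 (∫ φ : ProbabilityMeasure ℝ, (1 + z * (∫ x, f x ∂(φ : Measure ℝ) : ℝ)) ^
        (-((α.real Set.univ : ℝ) : ℂ)) ∂D)) := by
    refine tendsto_integral_of_dominated_convergence (fun _ => 1) (fun k => ?_)
      (integrable_const 1) (fun k => Eventually.of_forall fun φ => ?_) ?_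
    · have := (stronglyMeasurable_probabilityMeasure_integral (F k).measurable).measurable
      exact (by fun_prop : Measurable _).aestronglyMeasurable
    · exact norm_cpow_neg_le_one ha.le (hre _ (hFz k))
    · filter_upwards [hmean] with φ hφ
      have h1 : Tendsto (fun k => ∫ x, F k x ∂(φ : Measure ℝ)) atTop
          (𝓝 (∫ x, f x ∂(φ : Measure ℝ))) :=
        tendsto_integral_of_dominated_convergence (fun x => 2 * |f x|)
          (fun k => (F k).measurable.aestronglyMeasurable) (hφ.abs.const_mul 2)
          (fun k => Eventually.of_forall fun x => hFb k x) (Eventually.of_forall hFt)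
      exact (continuousAt_cpow_one_add (hre f hz) _).tendsto.comp
        (((Complex.continuous_ofReal.tendsto _).comp h1).const_mul z)
  have hR : Tendsto (fun k => Complex.exp (-∫ x, Complex.log (1 + z * F k x) ∂α)) atTop
      (𝓝 (Complex.exp (-∫ x, Complex.log (1 + z * f x) ∂α))) := by
    refine (Complex.continuous_exp.tendsto _).comp (Tendsto.neg ?_)
    refine tendsto_integral_of_dominated_convergence
      (fun x => Real.log (1 + 2 * ‖z‖) + Real.log (1 + |f x|) + Real.pi) (fun k => ?_)
      (((integrable_const _).add hlog).add (integrable_const _))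
      (fun k => Eventually.of_forall fun x => norm_log_one_add_le (hFz k x) (hFb k x))
      (Eventually.of_forall fun x => ?_)
    · have := (F k).measurable
      exact (by fun_prop : Measurable _).aestronglyMeasurable
    · refine Tendsto.clog ?_ (Or.inl ?_)
      · exact (((Complex.continuous_ofReal.tendsto _).comp (hFt x)).const_mul z).const_add 1
      · rw [Complex.add_re, Complex.one_re]
        linarith [hz x]
  refine tendsto_nhds_unique hL (hR.congr fun k => ?_)
  exact (hD.integral_cpow_simpleFunc ha (F k) (hFz k)).symm

/-- Almost surely the mean of a Dirichlet process exists. -/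
lemma IsDirichletProcess.ae_integrable_id (hD : IsDirichletProcess α D)
    [IsFiniteMeasure α] (ha : 0 < α.real Set.univ)
    (hlog : Integrable (fun x : ℝ => Real.log (1 + |x|)) α) :
    ∀ᵐ φ : ProbabilityMeasure ℝ ∂D, Integrable (fun x : ℝ => x) (φ : Measure ℝ) := by
  have hDp := hD.isProbabilityMeasure
  set a := α.real Set.univ with hadef
  set g : ℕ → ℝ → ℝ := fun n x => min |x| n with hg
  have hg0 : ∀ n x, 0 ≤ g n x := fun n x => le_min (abs_nonneg x) (Nat.cast_nonneg n)
  have hgm : ∀ n, Measurable (g n) := fun n => by fun_prop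
  have hgx : ∀ n x, g n x ≤ |x| := fun n x => min_le_left _ _
  have hgi : ∀ n (φ : ProbabilityMeasure ℝ), Integrable (g n) (φ : Measure ℝ) := fun n φ =>
    Integrable.of_bound (hgm n).aestronglyMeasurable n (Eventually.of_forall fun x => by
      rw [Real.norm_eq_abs, abs_of_nonneg (hg0 n x)]
      exact min_le_right _ _)
  set m : ℕ → ProbabilityMeasure ℝ → ℝ := fun n φ => ∫ x, g n x ∂(φ : Measure ℝ) with hm
  have hm0 : ∀ n φ, 0 ≤ m n φ := fun n φ => integral_nonneg (hg0 n)
  have hmm : ∀ n, Measurable (m n) := fun n =>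
    (stronglyMeasurable_probabilityMeasure_integral (hgm n)).measurable
  have hlog' : ∀ n, Integrable (fun x => Real.log (1 + |g n x|)) α := fun n =>
    hlog.mono' (by fun_prop : Measurable _).aestronglyMeasurable (Eventually.of_forall fun x => by
      rw [Real.norm_eq_abs, abs_of_nonneg (Real.log_nonneg (by simp)), abs_of_nonneg (hg0 n x)]
      exact Real.log_le_log (by linarith [hg0 n x]) (by linarith [hgx n x]))
  have hlogl : ∀ l : ℝ, 0 ≤ l → l ≤ 1 → ∀ x : ℝ,
      ‖Real.log (1 + l * |x|)‖ ≤ Real.log (1 + |x|) := fun l hl0 hl1 x => by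
    have h1 : 0 ≤ l * |x| := by positivity
    rw [Real.norm_eq_abs, abs_of_nonneg (Real.log_nonneg (by linarith))]
    exact Real.log_le_log (by linarith) (by nlinarith [abs_nonneg x])
  -- The truncation has integrable mean for every φ, so the identity applies to it; replacing
  -- min(|x|, n) by |x| in the logarithm makes the lower bound independent of n.
  have hkey : ∀ l : ℝ, 0 < l → l ≤ 1 → ∀ n,
      Real.exp (-∫ x, Real.log (1 + l * |x|) ∂α) ≤ ∫ φ, (1 + l * m n φ) ^ (-a) ∂D := by
    intro l hl hl1 n
    have h := hD.integral_cpow ha (hgm n) (hlog' n) (Eventually.of_forall (hgi n)) (z := l)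
      (fun x => by simpa using mul_nonneg hl.le (hg0 n x))
    have h1 : ∀ φ : ProbabilityMeasure ℝ, (1 + (l : ℂ) * (m n φ : ℝ)) ^ (-(a : ℂ)) =
        (((1 + l * m n φ) ^ (-a) : ℝ) : ℂ) := fun φ => by
      have : 0 ≤ l * m n φ := mul_nonneg hl.le (hm0 n φ)
      rw [Complex.ofReal_cpow (by linarith)]
      push_cast
      rfl
    have h2 : ∀ x : ℝ, Complex.log (1 + (l : ℂ) * (g n x : ℝ)) =
        ((Real.log (1 + l * g n x) : ℝ) : ℂ) := fun x => by
      have : 0 ≤ l * g n x := mul_nonneg hl.le (hg0 n x)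
      rw [Complex.ofReal_log (by linarith)]
      push_cast
      rfl
    simp only [h2] at h
    rw [integral_congr_ae (Eventually.of_forall h1), integral_complex_ofReal, integral_complex_ofReal] at h
    have h3 : ∫ φ, (1 + l * m n φ) ^ (-a) ∂D = Real.exp (-∫ x, Real.log (1 + l * g n x) ∂α) := by
      exact_mod_cast h
    rw [h3, Real.exp_le_exp, neg_le_neg_iff]
    refine integral_mono_of_nonneg (Eventually.of_forall fun x => Real.log_nonneg ?_) ?_
      (Eventually.of_forall fun x => Real.log_le_log ?_ ?_)
    · have : 0 ≤ l * g n x := mul_nonneg hl.le (hg0 n x)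
      linarith
    · exact hlog.mono' (by fun_prop : Measurable _).aestronglyMeasurable
        (Eventually.of_forall (hlogl l hl.le hl1))
    · have : 0 ≤ l * g n x := mul_nonneg hl.le (hg0 n x)
      linarith
    · have := mul_le_mul_of_nonneg_left (hgx n x) hl.le
      linarith
  set B : Set (ProbabilityMeasure ℝ) := {φ | ∫⁻ x, ENNReal.ofReal |x| ∂(φ : Measure ℝ) = ⊤} with hB
  have hBm : MeasurableSet B :=
    (measurable_probabilityMeasure_lintegral (by fun_prop)) (measurableSet_singleton _)
  have hmB : ∀ φ ∈ B, Tendsto (fun n => m n φ) atTop atTop := by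
    intro φ hφ
    have h1 : Tendsto (fun n => ∫⁻ x, ENNReal.ofReal (g n x) ∂(φ : Measure ℝ)) atTop (𝓝 ⊤) := by
      rw [← show ∫⁻ x, ENNReal.ofReal |x| ∂(φ : Measure ℝ) = ⊤ from hφ]
      refine lintegral_tendsto_of_tendsto_of_monotone
        (fun n => ((hgm n).ennreal_ofReal).aemeasurable)
        (Eventually.of_forall fun x i j hij => ENNReal.ofReal_le_ofReal
          (min_le_min_left _ (by exact_mod_cast hij))) (Eventually.of_forall fun x => ?_)
      refine (ENNReal.continuous_ofReal.tendsto _).comp (tendsto_const_nhds.congr' ?_)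
      filter_upwards [tendsto_natCast_atTop_atTop.eventually_ge_atTop |x|] with n hn
      exact (min_eq_left hn).symm
    have h2 : ∀ n, ENNReal.ofReal (m n φ) = ∫⁻ x, ENNReal.ofReal (g n x) ∂(φ : Measure ℝ) :=
      fun n => ofReal_integral_eq_lintegral_ofReal (hgi n φ) (Eventually.of_forall (hg0 n))
    simp only [← h2] at h1
    exact ENNReal.tendsto_ofReal_nhds_top.1 h1
  -- As n → ∞ the integrand tends to 0 on `B`, where the truncated means diverge, and it is at most
  -- 1 off `B`.
  have hprob : ∀ l : ℝ, 0 < l → l ≤ 1 →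
      Real.exp (-∫ x, Real.log (1 + l * |x|) ∂α) ≤ D.real Bᶜ := by
    intro l hl hl1
    have hle1 : ∀ n φ, (1 + l * m n φ) ^ (-a) ≤ 1 := fun n φ => by
      have : 0 ≤ l * m n φ := mul_nonneg hl.le (hm0 n φ)
      exact Real.rpow_le_one_of_one_le_of_nonpos (by linarith) (by linarith)
    have hge0 : ∀ n φ, 0 ≤ (1 + l * m n φ) ^ (-a) := fun n φ => by
      have : 0 ≤ l * m n φ := mul_nonneg hl.le (hm0 n φ)
      exact Real.rpow_nonneg (by linarith) _
    have hint : ∀ n, Integrable (fun φ => (1 + l * m n φ) ^ (-a)) D := fun n =>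
      Integrable.of_bound (by fun_prop : Measurable _).aestronglyMeasurable 1
        (Eventually.of_forall fun φ => by
          rw [Real.norm_eq_abs, abs_of_nonneg (hge0 n φ)]; exact hle1 n φ)
    have ht : Tendsto (fun n => ∫ φ in B, (1 + l * m n φ) ^ (-a) ∂D) atTop (𝓝 (∫ φ in B, 0 ∂D)) := by
      refine tendsto_integral_of_dominated_convergence (fun _ => 1)
        (fun n => (by fun_prop : Measurable _).aestronglyMeasurable) (integrable_const 1)
        (fun n => Eventually.of_forall fun φ => ?_) ?_
      · rw [Real.norm_eq_abs, abs_of_nonneg (hge0 n φ)]; exact hle1 n φ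
      · filter_upwards [ae_restrict_mem hBm] with φ hφ
        exact (tendsto_rpow_neg_atTop ha).comp
          (tendsto_atTop_add_const_left _ _ ((hmB φ hφ).const_mul_atTop hl))
    rw [integral_zero] at ht
    refine ge_of_tendsto (f := fun n => ∫ φ in B, (1 + l * m n φ) ^ (-a) ∂D + D.real Bᶜ)
      (by simpa using ht.add_const (D.real Bᶜ)) (Eventually.of_forall fun n => ?_)
    refine (hkey l hl hl1 n).trans ?_
    rw [← integral_add_compl hBm (hint n)]
    gcongr
    calc ∫ φ in Bᶜ, (1 + l * m n φ) ^ (-a) ∂D ≤ ∫ φ in Bᶜ, 1 ∂D :=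
          integral_mono (hint n).integrableOn (integrable_const _) (hle1 n)
      _ = D.real Bᶜ := by simp
  -- Letting the scale l = 1/(n+1) tend to 0 pushes the lower bound on the probability of `Bᶜ` up to
  -- 1.
  have hlim : Tendsto (fun n : ℕ => ∫ x, Real.log (1 + (1 / ((n : ℝ) + 1)) * |x|) ∂α) atTop
      (𝓝 (∫ x, 0 ∂α)) := by
    refine tendsto_integral_of_dominated_convergence (fun x => Real.log (1 + |x|))
      (fun n => (by fun_prop : Measurable _).aestronglyMeasurable) hlog
      (fun n => Eventually.of_forall fun x => hlogl _ (by positivity)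
        (by rw [div_le_one (by positivity)]; linarith [Nat.cast_nonneg (α := ℝ) n]) x)
      (Eventually.of_forall fun x => ?_)
    have h1 : Tendsto (fun n : ℕ => 1 + (1 / ((n : ℝ) + 1)) * |x|) atTop (𝓝 1) := by
      simpa using (tendsto_one_div_add_atTop_nhds_zero_nat (𝕜 := ℝ)).mul_const |x| |>.const_add 1
    simpa using h1.log one_ne_zero
  have hone : 1 ≤ D.real Bᶜ := by
    have h1 := (Real.continuous_exp.tendsto _).comp hlim.neg
    rw [integral_zero, neg_zero, Real.exp_zero] at h1
    exact le_of_tendsto h1 (Eventually.of_forall fun n => hprob _ (by positivity)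
        (by rw [div_le_one (by positivity)]; linarith [Nat.cast_nonneg (α := ℝ) n]))
  have hB0 : ∀ᵐ φ ∂D, φ ∈ Bᶜ := by
    rw [ae_iff]
    have h1 := probReal_compl_eq_one_sub (μ := D) hBm
    have h2 : D.real B = 0 := by linarith [measureReal_nonneg (μ := D) (s := B)]
    simpa [hB] using (measureReal_eq_zero_iff).1 h2
  filter_upwards [hB0] with φ hφ
  refine ⟨measurable_id.aestronglyMeasurable, ?_⟩
  rw [hasFiniteIntegral_iff_norm]
  exact lt_top_iff_ne_top.2 hφ

end

section

/-! ### Analytic continuation of the Markov–Krein identity -/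

lemma re_one_add_I_mul (w : ℂ) (y : ℝ) : (1 + Complex.I * w * y).re = 1 - w.im * y := by
  simp [sub_eq_add_neg]

lemma im_one_add_I_mul (w : ℂ) (y : ℝ) : (1 + Complex.I * w * y).im = w.re * y := by
  simp

lemma one_add_I_mul_mem_slitPlane {w : ℂ} (hw : 0 < w.re) (y : ℝ) :
    1 + Complex.I * w * y ∈ Complex.slitPlane := by
  rw [Complex.mem_slitPlane_iff, re_one_add_I_mul, im_one_add_I_mul]
  rcases eq_or_ne y 0 with rfl | hy
  · simp
  · exact Or.inr (mul_ne_zero hw.ne' hy)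

lemma re_mul_abs_le_norm {w : ℂ} (hw : 0 ≤ w.re) (y : ℝ) :
    w.re * |y| ≤ ‖1 + Complex.I * w * y‖ := by
  have := Complex.abs_im_le_norm (1 + Complex.I * w * y)
  rwa [im_one_add_I_mul, abs_mul, abs_of_nonneg hw] at this

/-- Since 1 = (1 + iwy) - iwy and ‖w‖|y| ≤ K Re w |y| ≤ K ‖1 + iwy‖, the base stays away from 0
uniformly in real y. The vertex w = 0 is allowed, so paths may start and end there. -/
lemma one_le_mul_norm_of_cone {w : ℂ} {K : ℝ} (hK : 0 ≤ K) (hw : ‖w‖ ≤ K * w.re) (y : ℝ) :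
    1 ≤ (1 + K) * ‖1 + Complex.I * w * y‖ := by
  have hre : 0 ≤ w.re := by
    rcases hK.eq_or_lt with rfl | hK
    · have : w = 0 := by simpa using hw
      simp [this]
    · exact nonneg_of_mul_nonneg_right ((norm_nonneg w).trans hw) hK
  have h1 : (1 : ℝ) ≤ ‖1 + Complex.I * w * y‖ + ‖w‖ * |y| := by
    calc (1 : ℝ) = ‖(1 + Complex.I * w * y) - Complex.I * w * y‖ := by simp
      _ ≤ ‖1 + Complex.I * w * y‖ + ‖Complex.I * w * y‖ := norm_sub_le _ _
      _ = _ := by simp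
  have h2 : ‖w‖ * |y| ≤ K * (w.re * |y|) := by
    rw [← mul_assoc]; gcongr
  have h3 := mul_le_mul_of_nonneg_left (re_mul_abs_le_norm hre y) hK
  linarith

lemma norm_cpow_neg_le_of_cone {a : ℝ} (ha : 0 ≤ a) {w : ℂ} {K : ℝ} (hK : 0 ≤ K)
    (hw : ‖w‖ ≤ K * w.re) (y : ℝ) :
    ‖(1 + Complex.I * w * y) ^ (-(a : ℂ))‖ ≤ (1 + K) ^ a := by
  have h := one_le_mul_norm_of_cone hK hw y
  have hpos : 0 < ‖1 + Complex.I * w * y‖ := by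
    by_contra h0
    have : ‖1 + Complex.I * w * y‖ = 0 := le_antisymm (not_lt.1 h0) (norm_nonneg _)
    rw [this] at h; linarith
  rw [← Complex.ofReal_neg, Complex.norm_cpow_real, Real.rpow_neg hpos.le,
    inv_le_iff_one_le_mul₀ (Real.rpow_pos_of_pos hpos _), ← Real.mul_rpow (by positivity) hpos.le]
  exact Real.one_le_rpow h ha

lemma cone_of_mem_ball {w₀ : ℂ} (hw₀ : 0 < w₀.re) {w : ℂ} (hw : w ∈ Metric.ball w₀ (w₀.re / 2)) :
    w₀.re / 2 < w.re ∧ ‖w‖ ≤ (‖w₀‖ + w₀.re / 2) / (w₀.re / 2) * w.re := by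
  rw [mem_ball_iff_norm] at hw
  have h1 : |(w - w₀).re| ≤ ‖w - w₀‖ := Complex.abs_re_le_norm _
  rw [Complex.sub_re] at h1
  have h2 := (abs_le.1 (h1.trans hw.le)).1
  have h2' := (abs_lt.1 (h1.trans_lt hw)).1
  have h3 : ‖w‖ ≤ ‖w₀‖ + w₀.re / 2 := by
    have := norm_add_le w₀ (w - w₀)
    rw [add_sub_cancel] at this
    linarith
  refine ⟨by linarith, ?_⟩
  rw [div_mul_eq_mul_div, le_div_iff₀ (by linarith)]
  have h4 : w₀.re / 2 ≤ w.re := by linarith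
  have h5 := norm_nonneg w
  have h6 : 0 < w₀.re / 2 := by linarith
  nlinarith

variable {Ω : Type*} [MeasurableSpace Ω] {μ : Measure Ω} [IsFiniteMeasure μ] {g : Ω → ℝ}

/-- Differentiating in w brings down g / (1 + iwg), whose modulus is at most 1 / Re w. Hence the
derivative is dominated by a constant and g needs no moments. -/
lemma differentiableOn_integral_cpow {a : ℝ} (ha : 0 ≤ a) (hg : Measurable g) :
    DifferentiableOn ℂ (fun w : ℂ => ∫ ω, (1 + Complex.I * w * g ω) ^ (-(a : ℂ)) ∂μ)
      {w | 0 < w.re} := by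
  intro w₀ (hw₀ : 0 < w₀.re)
  set ρ := w₀.re / 2 with hρ
  have hρ0 : 0 < ρ := by positivity
  set K := (‖w₀‖ + ρ) / ρ with hK
  have hK0 : 0 ≤ K := by positivity
  refine (hasDerivAt_integral_of_dominated_loc_of_deriv_le (Metric.ball_mem_nhds w₀ hρ0)
    (F := fun w ω => (1 + Complex.I * w * g ω) ^ (-(a : ℂ)))
    (F' := fun w ω => -(a : ℂ) * (1 + Complex.I * w * g ω) ^ (-(a : ℂ) - 1) *
      (Complex.I * g ω)) (bound := fun _ => a * (1 + K) ^ a / ρ)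
    (Eventually.of_forall fun w => (by fun_prop : Measurable _).aestronglyMeasurable)
    ?_ (by fun_prop : Measurable _).aestronglyMeasurable
    (Eventually.of_forall fun ω w hw => ?_) (integrable_const _)
    (Eventually.of_forall fun ω w hw => ?_)).2.differentiableAt.differentiableWithinAt
  · refine Integrable.of_bound (by fun_prop : Measurable _).aestronglyMeasurable ((1 + K) ^ a)
      (Eventually.of_forall fun ω => ?_)
    exact norm_cpow_neg_le_of_cone ha hK0 (cone_of_mem_ball hw₀ (Metric.mem_ball_self hρ0)).2 _
  · obtain ⟨h1, h2⟩ := cone_of_mem_ball hw₀ hw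
    have hne := Complex.slitPlane_ne_zero (one_add_I_mul_mem_slitPlane (hρ0.trans h1) (g ω))
    have h3 := re_mul_abs_le_norm (hρ0.trans h1).le (g ω)
    have h4 := norm_cpow_neg_le_of_cone ha hK0 h2 (g ω)
    rw [Complex.cpow_sub _ _ hne, Complex.cpow_one]
    simp only [norm_mul, norm_div, norm_neg, Complex.norm_real, Complex.norm_I, one_mul,
      Real.norm_eq_abs, abs_of_nonneg ha]
    have h5 : |g ω| / ‖1 + Complex.I * w * g ω‖ ≤ 1 / ρ := by
      rw [div_le_div_iff₀ (norm_pos_iff.2 hne) hρ0, one_mul]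
      refine le_trans ?_ h3
      rw [mul_comm]; gcongr
    calc _ = a * ‖(1 + Complex.I * w * g ω) ^ (-(a : ℂ))‖ *
          (|g ω| / ‖1 + Complex.I * w * g ω‖) := by ring
      _ ≤ a * (1 + K) ^ a * (1 / ρ) := by gcongr
      _ = _ := by ring
  · have h1 := (cone_of_mem_ball hw₀ hw).1
    have h2 : HasDerivAt (fun w : ℂ => 1 + Complex.I * w * g ω) (Complex.I * g ω) w := by
      simpa using (((hasDerivAt_id w).const_mul Complex.I).mul_const (g ω : ℂ)).const_add 1
    exact h2.cpow_const (one_add_I_mul_mem_slitPlane (hρ0.trans h1) (g ω))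

lemma integrable_clog_one_add {w : ℂ} (hw : 0 < w.re) (hg : Measurable g)
    (hlog : Integrable (fun ω => Real.log (1 + |g ω|)) μ) :
    Integrable (fun ω => Complex.log (1 + Complex.I * w * g ω)) μ := by
  obtain ⟨K, hK, hwK⟩ : ∃ K : ℝ, 0 ≤ K ∧ ‖w‖ ≤ K * w.re :=
    ⟨‖w‖ / w.re, by positivity, by rw [div_mul_cancel₀ _ hw.ne']⟩
  refine Integrable.mono' (((integrable_const (Real.log (1 + K) + Real.log (1 + ‖w‖))).add
    hlog).add (integrable_const Real.pi)) (by fun_prop : Measurable _).aestronglyMeasurable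
    (Eventually.of_forall fun ω => (norm_log_le_abs_log_add_pi _).trans ?_)
  simp only [Pi.add_apply]
  gcongr
  have h1 := one_le_mul_norm_of_cone hK hwK (g ω)
  have hpos := norm_pos_iff.2 (Complex.slitPlane_ne_zero (one_add_I_mul_mem_slitPlane hw (g ω)))
  have h2 : 0 ≤ Real.log (1 + K) + Real.log ‖1 + Complex.I * w * g ω‖ := by
    rw [← Real.log_mul (by positivity) hpos.ne']
    exact Real.log_nonneg h1
  have h3 : Real.log ‖1 + Complex.I * w * g ω‖ ≤ Real.log (1 + ‖w‖) + Real.log (1 + |g ω|) := by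
    rw [← Real.log_mul (by positivity) (by positivity)]
    refine Real.log_le_log hpos ?_
    calc ‖1 + Complex.I * w * g ω‖ ≤ ‖(1 : ℂ)‖ + ‖Complex.I * w * g ω‖ := norm_add_le _ _
      _ = 1 + ‖w‖ * |g ω| := by simp
      _ ≤ _ := by nlinarith [norm_nonneg w, abs_nonneg (g ω)]
  have h4 : 0 ≤ Real.log (1 + ‖w‖) := Real.log_nonneg (by simp)
  have h5 : 0 ≤ Real.log (1 + |g ω|) := Real.log_nonneg (by simp)
  have h6 : 0 ≤ Real.log (1 + K) := Real.log_nonneg (by simpa)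
  exact abs_le.2 ⟨by linarith, by linarith⟩

lemma differentiableOn_integral_clog (hg : Measurable g)
    (hlog : Integrable (fun ω => Real.log (1 + |g ω|)) μ) :
    DifferentiableOn ℂ (fun w : ℂ => ∫ ω, Complex.log (1 + Complex.I * w * g ω) ∂μ)
      {w | 0 < w.re} := by
  intro w₀ (hw₀ : 0 < w₀.re)
  set ρ := w₀.re / 2 with hρ
  have hρ0 : 0 < ρ := by positivity
  refine (hasDerivAt_integral_of_dominated_loc_of_deriv_le (Metric.ball_mem_nhds w₀ hρ0)
    (F := fun w ω => Complex.log (1 + Complex.I * w * g ω))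
    (F' := fun w ω => Complex.I * g ω / (1 + Complex.I * w * g ω)) (bound := fun _ => 1 / ρ)
    (Eventually.of_forall fun w => (by fun_prop : Measurable _).aestronglyMeasurable)
    (integrable_clog_one_add hw₀ hg hlog) (by fun_prop : Measurable _).aestronglyMeasurable
    (Eventually.of_forall fun ω w hw => ?_) (integrable_const _)
    (Eventually.of_forall fun ω w hw => ?_)).2.differentiableAt.differentiableWithinAt
  · have h1 := (cone_of_mem_ball hw₀ hw).1
    have hne := Complex.slitPlane_ne_zero (one_add_I_mul_mem_slitPlane (hρ0.trans h1) (g ω))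
    have h3 := re_mul_abs_le_norm (hρ0.trans h1).le (g ω)
    simp only [norm_mul, norm_div, Complex.norm_real, Complex.norm_I, one_mul, Real.norm_eq_abs]
    rw [div_le_div_iff₀ (norm_pos_iff.2 hne) hρ0, one_mul]
    refine le_trans ?_ h3
    rw [mul_comm]; gcongr
  · have h1 := (cone_of_mem_ball hw₀ hw).1
    have h2 : HasDerivAt (fun w : ℂ => 1 + Complex.I * w * g ω) (Complex.I * g ω) w := by
      simpa using (((hasDerivAt_id w).const_mul Complex.I).mul_const (g ω : ℂ)).const_add 1
    exact h2.clog (one_add_I_mul_mem_slitPlane (hρ0.trans h1) (g ω))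

variable {a : ℝ} {α : Measure ℝ} {D : Measure (ProbabilityMeasure ℝ)}

lemma measurable_mean : Measurable fun φ : ProbabilityMeasure ℝ => ∫ x, x ∂(φ : Measure ℝ) :=
  (stronglyMeasurable_probabilityMeasure_integral measurable_id).measurable

lemma IsDirichletProcess.isProbabilityMeasure_meanLaw (hD : IsDirichletProcess α D) :
    IsProbabilityMeasure (meanLaw D) := by
  have := hD.isProbabilityMeasure
  exact Measure.isProbabilityMeasure_map measurable_mean.aemeasurable

/-- The Markov–Krein identity on the imaginary axis. -/
lemma IsDirichletProcess.integral_cpow_meanLaw_of_real (ha : 0 < a) (hα : α ∈ massClass a)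
    (hD : IsDirichletProcess α D) (t u : ℝ) :
    ∫ x, (1 + Complex.I * u * (t * x : ℝ)) ^ (-(a : ℂ)) ∂(meanLaw D) =
      Complex.exp (-zeta (Complex.I * u * t) α id) := by
  obtain ⟨hfin, hmass, hlog⟩ := hα
  have hreal : α.real Set.univ = a := by rw [measureReal_def, hmass, ENNReal.toReal_ofReal ha.le]
  have h := hD.integral_cpow (hreal ▸ ha) measurable_id hlog
    (hD.ae_integrable_id (hreal ▸ ha) hlog) (z := Complex.I * u * t) (fun x => by simp)
  rw [hreal] at h
  rw [zeta, ← h, meanLaw, integral_map measurable_mean.aemeasurable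
    (by fun_prop : Measurable _).aestronglyMeasurable]
  push_cast
  simp only [mul_assoc, id]

/-- The Markov–Krein identity on a half-plane. -/
lemma IsDirichletProcess.integral_cpow_meanLaw (ha : 0 < a) (hα : α ∈ massClass a)
    (hD : IsDirichletProcess α D) (t : ℝ) {w : ℂ} (hw : 0 < w.re) :
    ∫ x, (1 + Complex.I * w * (t * x : ℝ)) ^ (-(a : ℂ)) ∂(meanLaw D) =
      Complex.exp (-zeta (Complex.I * w * t) α id) := by
  have hpr := hD.isProbabilityMeasure_meanLaw
  have hfin := hα.1
  have hU : IsOpen {w : ℂ | 0 < w.re} := isOpen_lt continuous_const Complex.continuous_re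
  have hz : ∀ w : ℂ, zeta (Complex.I * w * t) α id =
      ∫ x, Complex.log (1 + Complex.I * w * (t * x : ℝ)) ∂α := fun w => by
    rw [zeta]
    push_cast
    simp only [mul_assoc, id]
  have hlog : Integrable (fun x : ℝ => Real.log (1 + |t * x|)) α := by
    refine Integrable.mono' ((integrable_const (Real.log (1 + |t|))).add hα.2.2)
      (by fun_prop : Measurable _).aestronglyMeasurable (Eventually.of_forall fun x => ?_)
    rw [Real.norm_eq_abs, abs_of_nonneg (Real.log_nonneg (by linarith [abs_nonneg (t * x)])), Pi.add_apply,
      ← Real.log_mul (by positivity) (by positivity), abs_mul]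
    exact Real.log_le_log (by positivity) (by nlinarith [abs_nonneg t, abs_nonneg x])
  have h1 := (differentiableOn_integral_cpow (μ := meanLaw D) (g := fun x => t * x) ha.le
    (by fun_prop)).analyticOnNhd hU
  have h2 := (differentiableOn_integral_clog (μ := α) (g := fun x => t * x)
    (by fun_prop) hlog).neg.cexp.analyticOnNhd hU
  -- Both sides are holomorphic on the half-plane, and the previous lemma gives their equality at
  -- real points near 1.
  have h3 := h1.eqOn_of_preconnected_of_frequently_eq h2 (convex_halfSpace_re_gt 0).isPreconnected
    (z₀ := ((1 : ℝ) : ℂ)) (by simp) (frequently_eq_of_eventually_ofReal ?_) hw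
  · rw [hz]
    exact h3
  · refine Eventually.of_forall fun u => ?_
    have := hD.integral_cpow_meanLaw_of_real ha hα t u
    rw [hz] at this
    exact this

end

/-! ### Euler type integrals along a path -/

lemma one_add_I_mul_mem_slitPlane_of_cone {w : ℂ} {K : ℝ} (hK : 0 ≤ K) (hw : ‖w‖ ≤ K * w.re)
    (y : ℝ) : 1 + Complex.I * w * y ∈ Complex.slitPlane := by
  rcases lt_or_ge 0 w.re with h | h
  · exact one_add_I_mul_mem_slitPlane h y
  · have : w = 0 := norm_le_zero_iff.1 (hw.trans (mul_nonpos_of_nonneg_of_nonpos hK h))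
    simp [this]

lemma hasDerivAt_cpow_const_of_real {f : ℝ → ℂ} {f' c : ℂ} {x : ℝ} (hf : HasDerivAt f f' x)
    (h0 : f x ∈ Complex.slitPlane) :
    HasDerivAt (fun x => f x ^ c) (f x ^ c * (c * f' / f x)) x := by
  refine ((Complex.hasStrictDerivAt_cpow_const (c := c) h0).hasDerivAt.scomp x hf).congr_deriv ?_
  rw [Complex.cpow_sub _ _ (Complex.slitPlane_ne_zero h0), Complex.cpow_one, smul_eq_mul]
  ring

/-- An Euler integral along a path `w` in a cone, with weight `B = A' / (a w - c)` where `A`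
vanishes at both end points, evaluates to a power. -/
lemma integral_cpow_mul_eq_cpow_mul_integral {w w' A B : ℝ → ℂ} {a c K : ℝ} (ha : 0 ≤ a)
    (hK : 0 ≤ K) (hw : ContinuousOn w (Set.Icc 0 1))
    (hcone : ∀ s ∈ Set.Icc (0 : ℝ) 1, ‖w s‖ ≤ K * (w s).re) {S : Set ℝ} (hS : S.Countable)
    (hwd : ∀ s ∈ Set.Ioo 0 1 \ S, HasDerivAt w (w' s) s)
    (hA : ContinuousOn A (Set.Icc 0 1)) (hA0 : A 0 = 0) (hA1 : A 1 = 0)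
    (hAd : ∀ s ∈ Set.Ioo 0 1 \ S, HasDerivAt A (B s * (a * w s - c)) s)
    (hAB : ∀ s ∈ Set.Ioo 0 1 \ S, A s * w' s = B s * (w s * (w s - 1)))
    (hB : IntervalIntegrable B volume 0 1) (y : ℝ) :
    ∫ s in (0 : ℝ)..1, (1 + Complex.I * w s * y) ^ (-(a : ℂ)) * B s =
      (1 + Complex.I * y) ^ (-(c : ℂ)) * ∫ s in (0 : ℝ)..1, B s := by
  have hI : Set.uIoc (0 : ℝ) 1 = Set.Ioc 0 1 := Set.uIoc_of_le zero_le_one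
  have hsub : Set.Ioc (0 : ℝ) 1 ⊆ Set.Icc 0 1 := Set.Ioc_subset_Icc_self
  obtain ⟨R, hR⟩ := isCompact_Icc.exists_bound_of_continuousOn hw
  have hslit : ∀ s ∈ Set.Icc (0 : ℝ) 1, ∀ y : ℝ, 1 + Complex.I * w s * y ∈ Complex.slitPlane :=
    fun s hs y => one_add_I_mul_mem_slitPlane_of_cone hK (hcone s hs) y
  have hcont : ∀ y : ℝ, ContinuousOn (fun s => (1 + Complex.I * w s * y) ^ (-(a : ℂ)))
      (Set.Icc 0 1) := fun y =>
    ContinuousOn.cpow (by fun_prop) continuousOn_const fun s hs => hslit s hs y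
  have hcont' : ∀ y : ℝ, ContinuousOn (fun s => -(a : ℂ) * (Complex.I * w s) *
      ((1 + Complex.I * w s * y) ^ (-(a : ℂ)) / (1 + Complex.I * w s * y))) (Set.Icc 0 1) :=
    fun y => (by fun_prop : ContinuousOn (fun s => -(a : ℂ) * (Complex.I * w s)) _).mul
      ((hcont y).div (by fun_prop) fun s hs => Complex.slitPlane_ne_zero (hslit s hs y))
  set F : ℝ → ℝ → ℂ := fun y s => (1 + Complex.I * w s * y) ^ (-(a : ℂ)) * B s with hF
  set F' : ℝ → ℝ → ℂ := fun y s => -(a : ℂ) * (Complex.I * w s) *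
      ((1 + Complex.I * w s * y) ^ (-(a : ℂ)) / (1 + Complex.I * w s * y)) * B s with hF'
  have hFi : ∀ y, IntervalIntegrable (F y) volume 0 1 := fun y => by
    refine hB.continuousOn_mul ?_
    rw [Set.uIcc_of_le zero_le_one]; exact hcont y
  have hder : ∀ y, IntervalIntegrable (F' y) volume 0 1 ∧
      HasDerivAt (fun y => ∫ s in (0 : ℝ)..1, F y s) (∫ s in (0 : ℝ)..1, F' y s) y := by
    intro y
    refine intervalIntegral.hasDerivAt_integral_of_dominated_loc_of_deriv_le
      (bound := fun s => a * R * ((1 + K) ^ a * (1 + K)) * ‖B s‖) univ_mem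
      (Eventually.of_forall fun y => (intervalIntegrable_iff.1 (hFi y)).aestronglyMeasurable) (hFi y) ?_
      (Eventually.of_forall fun s hs y _ => ?_) (hB.norm.const_mul _)
      (Eventually.of_forall fun s hs y _ => ?_)
    · refine (intervalIntegrable_iff.1 (hB.continuousOn_mul ?_)).aestronglyMeasurable
      rw [Set.uIcc_of_le zero_le_one]; exact hcont' y
    · rw [hI] at hs
      have h1 := norm_cpow_neg_le_of_cone ha hK (hcone s (hsub hs)) y
      have h2 := one_le_mul_norm_of_cone hK (hcone s (hsub hs)) y
      have hpos := norm_pos_iff.2 (Complex.slitPlane_ne_zero (hslit s (hsub hs) y))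
      simp only [hF', norm_mul, norm_div, norm_neg, Complex.norm_real, Complex.norm_I, one_mul,
        Real.norm_eq_abs, abs_of_nonneg ha]
      have h3 : ‖1 + Complex.I * w s * y‖⁻¹ ≤ 1 + K := by
        rw [inv_le_iff_one_le_mul₀ hpos]; exact h2
      have := hR s (hsub hs)
      have hR0 : 0 ≤ R := (norm_nonneg _).trans this
      rw [div_eq_mul_inv]
      gcongr
    · rw [hI] at hs
      have h2 : HasDerivAt (fun y : ℝ => 1 + Complex.I * w s * y) (Complex.I * w s) y := by
        simpa using ((hasDerivAt_id y).ofReal_comp.const_mul (Complex.I * w s)).const_add 1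
      have hsl := hslit s (hsub hs) y
      refine ((hasDerivAt_cpow_const_of_real h2 hsl).mul_const (B s)).congr_deriv ?_
      simp only [hF']
      ring
  -- The integrand equals d/ds [(1 + iwy)^(-a) A], and `A` vanishes at both ends. Here A w' = B w
  -- (w-1) and A' = B (aw - c) make all terms collapse.
  have hE : ∀ y : ℝ, ∫ s in (0 : ℝ)..1, Complex.I * (Complex.I * c * F y s +
      (1 + Complex.I * y) * F' y s) = 0 := by
    intro y
    have hint : IntervalIntegrable (fun s => Complex.I * (Complex.I * c * F y s +
      (1 + Complex.I * y) * F' y s)) volume 0 1 :=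
      (((hFi y).const_mul _).add ((hder y).1.const_mul _)).const_mul _
    rw [integral_eq_of_hasDerivAt_off_countable_of_le
      (fun s => (1 + Complex.I * w s * y) ^ (-(a : ℂ)) * A s) _ zero_le_one hS
      ((hcont y).mul hA) (fun s hs => ?_) hint]
    · simp [hA0, hA1]
    · have hs' : s ∈ Set.Icc (0 : ℝ) 1 := Set.Ioo_subset_Icc_self hs.1
      have hsl := hslit s hs' y
      have hne := Complex.slitPlane_ne_zero hsl
      have h1 : HasDerivAt (fun s => 1 + Complex.I * w s * y) (Complex.I * w' s * y) s :=
        (((hwd s hs).const_mul Complex.I).mul_const (y : ℂ)).const_add 1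
      have h2 := (hasDerivAt_cpow_const_of_real h1 hsl (c := -(a : ℂ))).mul (hAd s hs)
      refine h2.congr_deriv ?_
      have h3 := hAB s hs
      simp only [hF, hF']
      field_simp
      linear_combination (-(a : ℂ) * (1 + Complex.I * w s * y) ^ (-(a : ℂ)) * Complex.I * y) * h3 +
        (1 + Complex.I * w s * y) ^ (-(a : ℂ)) * B s *
          (a * w s - c + Complex.I * y * w s * (a - c)) * Complex.I_sq
  -- The relation (1 + iy) Φ' = -ic Φ says that (1 + iy)^c Φ is constant; its value is then read off
  -- at y = 0.
  have hconst : ∀ y : ℝ, HasDerivAt (fun y : ℝ => (1 + Complex.I * y) ^ (c : ℂ) *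
      ∫ s in (0 : ℝ)..1, F y s) 0 y := by
    intro y
    have hsl : 1 + Complex.I * y ∈ Complex.slitPlane := Or.inl (by simp)
    have hne := Complex.slitPlane_ne_zero hsl
    have h1 : HasDerivAt (fun y : ℝ => 1 + Complex.I * (y : ℂ)) Complex.I y := by
      simpa using ((hasDerivAt_id y).ofReal_comp.const_mul Complex.I).const_add 1
    refine ((hasDerivAt_cpow_const_of_real h1 hsl).mul (hder y).2).congr_deriv ?_
    have h2 := hE y
    rw [intervalIntegral.integral_const_mul, intervalIntegral.integral_add ((hFi y).const_mul _)
      ((hder y).1.const_mul _), intervalIntegral.integral_const_mul,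
      intervalIntegral.integral_const_mul, mul_eq_zero, or_iff_right Complex.I_ne_zero] at h2
    field_simp
    linear_combination (1 + Complex.I * (y : ℂ)) ^ (c : ℂ) * h2
  have hslit1 : 1 + Complex.I * y ∈ Complex.slitPlane := Or.inl (by simp)
  have h := is_const_of_deriv_eq_zero (fun y => (hconst y).differentiableAt)
    (fun y => (hconst y).deriv) y 0
  simp only [hF] at h
  rw [Complex.cpow_neg, ← div_eq_inv_mul, eq_div_iff, mul_comm, h]
  · simp
  · simp [Complex.cpow_eq_zero_iff, Complex.slitPlane_ne_zero hslit1]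

/-! ### The case c ≤ a: beta mixtures -/

lemma isFiniteMeasure_betaLaw {c d : ℝ} (hc : 0 < c) (hd : 0 ≤ d) : IsFiniteMeasure (betaLaw c d) := by
  unfold betaLaw
  split_ifs with h
  · infer_instance
  · have := isProbabilityMeasureBeta hc (hd.lt_of_ne' h)
    infer_instance

/-- Euler's integral for the power function, as a beta mixture. -/
lemma integral_cpow_betaLaw {a c : ℝ} (hc : 0 < c) (hca : c ≤ a) (y : ℝ) :
    ∫ u in Set.Icc (0 : ℝ) 1, (1 + Complex.I * u * y) ^ (-(a : ℂ)) ∂(betaLaw c (a - c)) =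
      (1 + Complex.I * y) ^ (-(c : ℂ)) := by
  rcases hca.eq_or_lt with rfl | hca
  · have : (1 : ℝ) ∈ Set.Icc (0 : ℝ) 1 := by simp
    rw [betaLaw, if_pos (sub_self c)]
    rw [restrict_dirac' measurableSet_Icc, if_pos this, integral_dirac]
    simp
  set d := a - c with hd
  have hd0 : 0 < d := sub_pos.2 hca
  have hbeta := beta_pos hc hd0
  have hcre : 0 < (c : ℂ).re := by simpa
  have hdre : 0 < (d : ℂ).re := by simpa
  set B : ℝ → ℂ := fun u => (u : ℂ) ^ ((c : ℂ) - 1) * (1 - (u : ℂ)) ^ ((d : ℂ) - 1) with hB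
  have hBint : IntervalIntegrable B volume 0 1 := Complex.betaIntegral_convergent hcre hdre
  have hBval : ∫ u in (0 : ℝ)..1, B u = (beta c d : ℝ) := by
    have := Complex.betaIntegral_eq_Gamma_mul_div c d hcre hdre
    rw [Complex.betaIntegral] at this
    rw [hB, this, beta, ← Complex.ofReal_add, Complex.Gamma_ofReal, Complex.Gamma_ofReal,
      Complex.Gamma_ofReal]
    push_cast
    rfl
  -- The minus sign in `A` arises because the weight uses 1 - s while the general lemma has w - 1.
  have key := integral_cpow_mul_eq_cpow_mul_integral (w := fun s => (s : ℂ)) (w' := fun _ => 1)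
    (A := fun s => ((-(s ^ c * (1 - s) ^ d) : ℝ) : ℂ)) (B := B) (a := a) (c := c) (K := 1)
    (by linarith) zero_le_one (by fun_prop)
    (fun s hs => by simp [abs_of_nonneg hs.1]) Set.countable_empty
    (fun s _ => (hasDerivAt_id s).ofReal_comp) ?_ (by simp [hc.ne'])
    (by simp [hd0.ne']) ?_ ?_ hBint y
  · rw [betaLaw, if_neg hd0.ne', betaMeasure, restrict_withDensity measurableSet_Icc,
      integral_withDensity_eq_integral_toReal_smul
        (f := betaPDF c d) (measurable_betaPDFReal c d).ennreal_ofReal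
        (Eventually.of_forall fun _ => ENNReal.ofReal_lt_top), integral_Icc_eq_integral_Ioo]
    rw [intervalIntegral.integral_of_le zero_le_one, integral_Ioc_eq_integral_Ioo, hBval] at key
    have h1 : ∀ u ∈ Set.Ioo (0 : ℝ) 1, (betaPDF c d u).toReal •
        (1 + Complex.I * u * y) ^ (-(a : ℂ)) = ((beta c d : ℝ) : ℂ)⁻¹ *
          ((1 + Complex.I * u * y) ^ (-(a : ℂ)) * B u) := fun u hu => by
      have hu1 : 0 ≤ 1 - u := by linarith [hu.2]
      have hu0 := hu.1.le
      rw [betaPDF_of_pos_lt_one hu.1 hu.2, ENNReal.toReal_ofReal (by positivity),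
        Complex.real_smul, hB]
      push_cast
      rw [Complex.ofReal_cpow hu0, Complex.ofReal_cpow hu1]
      push_cast
      ring
    rw [setIntegral_congr_fun measurableSet_Ioo h1, integral_const_mul, key]
    have : ((beta c d : ℝ) : ℂ) ≠ 0 := by exact_mod_cast hbeta.ne'
    field_simp
  · refine ContinuousOn.comp' Complex.continuous_ofReal.continuousOn (t := Set.univ) ?_
      (fun _ _ => trivial)
    exact (((continuousOn_id.rpow_const fun _ _ => Or.inr hc.le).mul
      ((continuousOn_const.sub continuousOn_id).rpow_const fun _ _ => Or.inr hd0.le))).neg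
  · intro s hs
    have hs0 : 0 < s := hs.1.1
    have hs1 : 0 < 1 - s := by linarith [hs.1.2]
    have h1 : HasDerivAt (fun s : ℝ => s ^ c) (c * s ^ (c - 1)) s :=
      Real.hasDerivAt_rpow_const (Or.inl hs0.ne')
    have h2 : HasDerivAt (fun s : ℝ => (1 - s) ^ d) (-1 * d * (1 - s) ^ (d - 1)) s :=
      ((hasDerivAt_id s).const_sub 1).rpow_const (Or.inl hs1.ne')
    refine (h1.mul h2).neg.ofReal_comp.congr_deriv ?_
    simp only [hB]
    have e1 : s ^ c = s ^ (c - 1) * s := by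
      rw [← Real.rpow_add_one hs0.ne', sub_add_cancel]
    have e2 : (1 - s) ^ d = (1 - s) ^ (d - 1) * (1 - s) := by
      rw [← Real.rpow_add_one hs1.ne', sub_add_cancel]
    have e3 : (s : ℂ) ^ ((c : ℂ) - 1) = ((s ^ (c - 1) : ℝ) : ℂ) := by
      rw [Complex.ofReal_cpow hs0.le]; push_cast; rfl
    have e4 : (1 - (s : ℂ)) ^ ((d : ℂ) - 1) = (((1 - s) ^ (d - 1) : ℝ) : ℂ) := by
      rw [Complex.ofReal_cpow hs1.le]; push_cast; rfl
    rw [e1, e2, e3, e4]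
    push_cast [hd]
    ring
  · intro s hs
    have hs0 : 0 < s := hs.1.1
    have hs1 : 0 < 1 - s := by linarith [hs.1.2]
    simp only [hB]
    have e1 : s ^ c = s ^ (c - 1) * s := by
      rw [← Real.rpow_add_one hs0.ne', sub_add_cancel]
    have e2 : (1 - s) ^ d = (1 - s) ^ (d - 1) * (1 - s) := by
      rw [← Real.rpow_add_one hs1.ne', sub_add_cancel]
    have e3 : (s : ℂ) ^ ((c : ℂ) - 1) = ((s ^ (c - 1) : ℝ) : ℂ) := by
      rw [Complex.ofReal_cpow hs0.le]; push_cast; rfl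
    have e4 : (1 - (s : ℂ)) ^ ((d : ℂ) - 1) = (((1 - s) ^ (d - 1) : ℝ) : ℂ) := by
      rw [Complex.ofReal_cpow hs1.le]; push_cast; rfl
    rw [e1, e2, e3, e4]
    push_cast
    ring

/-- The transform of order `c ≤ a` of the mean of a Dirichlet process is a beta mixture. -/
lemma IsDirichletProcess.integral_cpow_meanLaw_of_le {a c : ℝ} {α : Measure ℝ}
    {D : Measure (ProbabilityMeasure ℝ)} (ha : 0 < a) (hα : α ∈ massClass a)
    (hD : IsDirichletProcess α D) (hc : 0 < c) (hca : c ≤ a) (t : ℝ) :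
    ∫ x, (1 + Complex.I * t * x) ^ (-(c : ℂ)) ∂(meanLaw D) =
      ∫ u in Set.Icc (0 : ℝ) 1, Complex.exp (-zeta (Complex.I * u * t) α id)
        ∂(betaLaw c (a - c)) := by
  have hpr := hD.isProbabilityMeasure_meanLaw
  have hfin := isFiniteMeasure_betaLaw hc (sub_nonneg.2 hca)
  have h1 : ∀ x : ℝ, (1 + Complex.I * t * x) ^ (-(c : ℂ)) = ∫ u in Set.Icc (0 : ℝ) 1,
      (1 + Complex.I * u * (t * x : ℝ)) ^ (-(a : ℂ)) ∂(betaLaw c (a - c)) := fun x => by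
    rw [integral_cpow_betaLaw hc hca (t * x)]
    push_cast
    rw [mul_assoc]
  simp only [h1, ← hD.integral_cpow_meanLaw_of_real ha hα]
  refine integral_integral_swap (Integrable.of_bound ?_ 1 (Eventually.of_forall fun q => ?_))
  · exact (by fun_prop : Measurable fun q : ℝ × ℝ => (1 + Complex.I * (q.2 : ℂ) *
      ((t * q.1 : ℝ) : ℂ)) ^ (-(a : ℂ))).aestronglyMeasurable
  · simp only [Function.uncurry]
    rw [add_comm, add_comm]
    exact norm_cpow_neg_le_one ha.le (by simp)

section

/-! ### Geometry of the loops -/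

namespace IsLoopAroundOne

variable {γ : ℝ → ℂ}

/-- Glues the C¹ pieces by induction: the exceptional points are breakpoints, and the derivative is
bounded on each compact piece. -/
lemma exists_smooth_off_countable (hγ : IsLoopAroundOne γ) :
    ContinuousOn γ (Set.Icc 0 1) ∧ ∃ S : Set ℝ, S.Countable ∧ ∃ L : ℝ,
      ∀ s ∈ Set.Ioo (0 : ℝ) 1 \ S, HasDerivAt γ (deriv γ s) s ∧ ‖deriv γ s‖ ≤ L := by
  obtain ⟨n, p, hp0, hpn, hp⟩ := hγ.piecewise
  have hmain : ∀ k ≤ n, 0 ≤ p k ∧ ContinuousOn γ (Set.Icc 0 (p k)) ∧ ∃ L : ℝ,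
      ∀ s ∈ Set.Ioo (0 : ℝ) (p k) \ Set.range p, HasDerivAt γ (deriv γ s) s ∧ ‖deriv γ s‖ ≤ L := by
    intro k
    induction k with
    | zero =>
      intro _
      rw [hp0]
      exact ⟨le_rfl, by simp, 0, fun s hs => absurd (hs.1.1.trans hs.1.2) (lt_irrefl _)⟩
    | succ k ih =>
      intro hk
      obtain ⟨h0, hc, L, hL⟩ := ih (by omega)
      obtain ⟨hlt, hd⟩ := hp k (by omega)
      have hu : UniqueDiffOn ℝ (Set.Icc (p k) (p (k + 1))) := uniqueDiffOn_Icc hlt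
      obtain ⟨L', hL'⟩ := isCompact_Icc.exists_bound_of_continuousOn
        (hd.continuousOn_derivWithin hu le_rfl)
      refine ⟨h0.trans hlt.le, ?_, max L L', fun s hs => ?_⟩
      · rw [← Set.Icc_union_Icc_eq_Icc h0 hlt.le]
        exact hc.union_of_isClosed hd.continuousOn isClosed_Icc isClosed_Icc
      · rcases lt_trichotomy s (p k) with h | h | h
        · obtain ⟨h1, h2⟩ := hL s ⟨⟨hs.1.1, h⟩, hs.2⟩
          exact ⟨h1, h2.trans (le_max_left _ _)⟩
        · exact absurd ⟨k, h.symm⟩ hs.2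
        · have hn : Set.Icc (p k) (p (k + 1)) ∈ 𝓝 s := Icc_mem_nhds h hs.1.2
          have hds : DifferentiableAt ℝ γ s :=
            ((hd.differentiableOn one_ne_zero) s ⟨h.le, hs.1.2.le⟩).differentiableAt hn
          refine ⟨hds.hasDerivAt, ?_⟩
          have := hL' s ⟨h.le, hs.1.2.le⟩
          rw [derivWithin_of_mem_nhds hn] at this
          exact this.trans (le_max_right _ _)
  obtain ⟨-, h1, L, hL⟩ := hmain n le_rfl
  rw [hpn] at h1 hL
  exact ⟨h1, _, Set.countable_range p, L, hL⟩

/-- First-order expansion at an end point. The sign σ is 1 at the start and -1 at the finish, so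
that σ Re v > 0 says the path enters the right half-plane at linear speed. -/
lemma eventually_bounds_of_hasDerivWithinAt {e σ : ℝ} {v : ℂ} {T : Set ℝ}
    (hσ : |σ| = 1) (hT : ∀ s ∈ T, s - e = σ * |s - e|) (he : γ e = 0)
    (hd : HasDerivWithinAt γ v T e) (hv : 0 < σ * v.re) :
    ∀ᶠ s in 𝓝[T] e, σ * v.re / 2 * |s - e| ≤ (γ s).re ∧
      ‖γ s‖ ≤ (‖v‖ + σ * v.re / 2) * |s - e| := by
  have h := (hasDerivWithinAt_iff_isLittleO.1 hd).def (half_pos hv)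
  filter_upwards [h, self_mem_nhdsWithin] with s hs hsT
  rw [he, sub_zero, Real.norm_eq_abs] at hs
  constructor
  · have h1 := (Complex.abs_re_le_norm _).trans hs
    have h2 : ((s - e) • v).re = σ * v.re * |s - e| := by
      rw [Complex.smul_re, smul_eq_mul, hT s hsT, abs_mul, hσ, one_mul, abs_abs]
      ring
    rw [Complex.sub_re, h2] at h1
    linarith [(abs_le.1 h1).1]
  · calc ‖γ s‖ = ‖(γ s - (s - e) • v) + (s - e) • v‖ := by rw [sub_add_cancel]
      _ ≤ ‖γ s - (s - e) • v‖ + ‖(s - e) • v‖ := norm_add_le _ _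
      _ ≤ σ * v.re / 2 * |s - e| + |s - e| * ‖v‖ := by
        rw [norm_smul, Real.norm_eq_abs]
        gcongr
      _ = _ := by ring

/-- A loop stays in a cone and its modulus is comparable to `s (1 - s)`. -/
lemma exists_bounds (hγ : IsLoopAroundOne γ) : ∃ k > 0, ∃ C, ∀ s ∈ Set.Icc (0 : ℝ) 1,
    k * (s * (1 - s)) ≤ (γ s).re ∧ ‖γ s‖ ≤ C * (s * (1 - s)) := by
  have hcont := hγ.exists_smooth_off_countable.1
  -- Membership in [0, 1] is repeated because the induction over a compact set also meets sets T not
  -- contained in [0, 1].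
  suffices h : ∃ k > 0, ∃ C, ∀ s ∈ Set.Icc (0 : ℝ) 1, s ∈ Set.Icc (0 : ℝ) 1 →
      k * (s * (1 - s)) ≤ (γ s).re ∧ ‖γ s‖ ≤ C * (s * (1 - s)) by
    obtain ⟨k, hk, C, h⟩ := h
    exact ⟨k, hk, C, fun s hs => h s hs hs⟩
  refine isCompact_Icc.induction_on (p := fun T => ∃ k > 0, ∃ C, ∀ s ∈ T,
    s ∈ Set.Icc (0 : ℝ) 1 → k * (s * (1 - s)) ≤ (γ s).re ∧ ‖γ s‖ ≤ C * (s * (1 - s)))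
    ⟨1, one_pos, 0, by simp⟩ ?_ ?_ ?_
  · rintro s t hst ⟨k, hk, C, h⟩
    exact ⟨k, hk, C, fun s hs => h s (hst hs)⟩
  · rintro s t ⟨k, hk, C, h⟩ ⟨k', hk', C', h'⟩
    refine ⟨min k k', lt_min hk hk', max C C', ?_⟩
    rintro s (hs | hs) hsI
    all_goals have hq : 0 ≤ s * (1 - s) := mul_nonneg hsI.1 (sub_nonneg.2 hsI.2)
    · obtain ⟨h1, h2⟩ := h s hs hsI
      exact ⟨(mul_le_mul_of_nonneg_right (min_le_left _ _) hq).trans h1,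
        h2.trans (mul_le_mul_of_nonneg_right (le_max_left _ _) hq)⟩
    · obtain ⟨h1, h2⟩ := h' s hs hsI
      exact ⟨(mul_le_mul_of_nonneg_right (min_le_right _ _) hq).trans h1,
        h2.trans (mul_le_mul_of_nonneg_right (le_max_right _ _) hq)⟩
  · intro e he
    rcases he.1.eq_or_lt with rfl | he0
    · have hv := hγ.start_dir
      -- `derivWithin` is 0 where the derivative does not exist, so the strict sign condition forces
      -- differentiability.
      have hd : DifferentiableWithinAt ℝ γ (Set.Icc 0 1) 0 := by
        by_contra h
        rw [derivWithin_zero_of_not_differentiableWithinAt h] at hv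
        simp at hv
      have h1 := eventually_bounds_of_hasDerivWithinAt (σ := 1) (T := Set.Icc 0 1) (by simp)
        (fun s hs => by simp [abs_of_nonneg hs.1]) hγ.start hd.hasDerivWithinAt (by simpa using hv)
      set v := derivWithin γ (Set.Icc 0 1) 0
      have h2 : ∀ᶠ s in 𝓝[Set.Icc (0 : ℝ) 1] 0, s < 1 / 2 :=
        nhdsWithin_le_nhds (Iio_mem_nhds (by norm_num))
      refine ⟨_, h1.and h2, 1 * v.re / 2, by linarith, (‖v‖ + 1 * v.re / 2) * 2, ?_⟩
      rintro s ⟨⟨h3, h4⟩, h5⟩ hs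
      rw [sub_zero, abs_of_nonneg hs.1] at h3 h4
      have hs0 := hs.1
      constructor
      · refine le_trans ?_ h3
        gcongr
        nlinarith
      · refine h4.trans ?_
        rw [mul_assoc]
        gcongr
        nlinarith
    rcases he.2.eq_or_lt with rfl | he1
    · have hv := hγ.finish_dir
      have hd : DifferentiableWithinAt ℝ γ (Set.Icc 0 1) 1 := by
        by_contra h
        rw [derivWithin_zero_of_not_differentiableWithinAt h] at hv
        simp at hv
      have h1 := eventually_bounds_of_hasDerivWithinAt (σ := -1) (T := Set.Icc 0 1) (by simp)
        (fun s hs => by rw [abs_of_nonpos (sub_nonpos.2 hs.2)]; ring) hγ.finish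
        hd.hasDerivWithinAt (by linarith)
      set v := derivWithin γ (Set.Icc 0 1) 1
      have h2 : ∀ᶠ s in 𝓝[Set.Icc (0 : ℝ) 1] 1, 1 / 2 < s :=
        nhdsWithin_le_nhds (Ioi_mem_nhds (by norm_num))
      refine ⟨_, h1.and h2, -1 * v.re / 2, by linarith, (‖v‖ + -1 * v.re / 2) * 2, ?_⟩
      rintro s ⟨⟨h3, h4⟩, h5⟩ hs
      rw [abs_of_nonpos (sub_nonpos.2 hs.2), neg_sub] at h3 h4
      have hs1 : 0 ≤ 1 - s := sub_nonneg.2 hs.2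
      constructor
      · refine le_trans ?_ h3
        gcongr
        · linarith
        · nlinarith
      · refine h4.trans ?_
        rw [mul_assoc]
        gcongr
        · have := norm_nonneg v
          linarith
        · nlinarith
    · have hc := hcont e he
      have hre := (hγ.mem_slit e ⟨he0, he1⟩).1
      have hq : 0 < e * (1 - e) := mul_pos he0 (sub_pos.2 he1)
      have h1 : ∀ᶠ s in 𝓝[Set.Icc (0 : ℝ) 1] e, (γ e).re / 2 < (γ s).re :=
        (Complex.continuous_re.continuousAt.comp_continuousWithinAt hc).eventually
          (Ioi_mem_nhds (by simpa using hre))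
      have h2 : ∀ᶠ s in 𝓝[Set.Icc (0 : ℝ) 1] e, ‖γ s‖ < ‖γ e‖ + 1 :=
        hc.norm.eventually (Iio_mem_nhds (by linarith))
      have h3 : ∀ᶠ s in 𝓝[Set.Icc (0 : ℝ) 1] e, e * (1 - e) / 2 < s * (1 - s) :=
        nhdsWithin_le_nhds ((by fun_prop : Continuous fun s : ℝ => s * (1 - s)).continuousAt.eventually
          (Ioi_mem_nhds (by linarith)))
      refine ⟨_, (h1.and h2).and h3, (γ e).re / 2, by linarith,
        (‖γ e‖ + 1) / (e * (1 - e) / 2), ?_⟩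
      rintro s ⟨⟨h4, h5⟩, h6⟩ hs
      constructor
      · refine le_trans ?_ h4.le
        have : s * (1 - s) ≤ 1 := by nlinarith [hs.1, hs.2]
        nlinarith
      · refine h5.le.trans ?_
        rw [div_mul_eq_mul_div, le_div_iff₀ (by linarith)]
        gcongr

lemma exists_cone (hγ : IsLoopAroundOne γ) : ∃ K, 0 ≤ K ∧ ∀ s ∈ Set.Icc (0 : ℝ) 1,
    ‖γ s‖ ≤ K * (γ s).re := by
  obtain ⟨k, hk, C, h⟩ := hγ.exists_bounds
  have hC : 0 ≤ C := by
    have := (norm_nonneg _).trans (h (1 / 2) (by norm_num)).2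
    norm_num at this
    linarith
  refine ⟨C / k, by positivity, fun s hs => (h s hs).2.trans ?_⟩
  rw [div_mul_eq_mul_div, le_div_iff₀ hk, mul_assoc, mul_comm _ k]
  exact mul_le_mul_of_nonneg_left (h s hs).1 hC

lemma sub_one_mem_slitPlane (hγ : IsLoopAroundOne γ) {s : ℝ} (hs : s ∈ Set.Ioo (0 : ℝ) 1) :
    γ s - 1 ∈ Complex.slitPlane := by
  rw [Complex.mem_slitPlane_iff]
  by_cases h : (γ s).re ≤ 1
  · exact Or.inr (by simpa using (hγ.mem_slit s hs).2 h)
  · exact Or.inl (by simpa using h)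

lemma mem_slitPlane (hγ : IsLoopAroundOne γ) {s : ℝ} (hs : s ∈ Set.Ioo (0 : ℝ) 1) :
    γ s ∈ Complex.slitPlane :=
  Or.inl (hγ.mem_slit s hs).1

/-- γ - 1 never vanishes on [0, 1], being -1 at both ends, and the argument is at most π in modulus
on either side of the cut. This controls (γ - 1)^s for every s, even at the ends, where γ - 1 leaves
the slit plane. -/
lemma exists_bound_log (hγ : IsLoopAroundOne γ) : ∃ M, 0 ≤ M ∧ ∀ s ∈ Set.Icc (0 : ℝ) 1,
    γ s - 1 ≠ 0 ∧ ‖Complex.log (γ s - 1)‖ ≤ M := by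
  have hcont := hγ.exists_smooth_off_countable.1
  have hne : ∀ s ∈ Set.Icc (0 : ℝ) 1, γ s - 1 ≠ 0 := by
    intro s hs
    rcases hs.1.eq_or_lt with rfl | h0
    · simp [hγ.start]
    rcases hs.2.eq_or_lt with rfl | h1
    · simp [hγ.finish]
    · exact Complex.slitPlane_ne_zero (hγ.sub_one_mem_slitPlane ⟨h0, h1⟩)
  have hc : ContinuousOn (fun s => Real.log ‖γ s - 1‖) (Set.Icc 0 1) :=
    ((hcont.sub continuousOn_const).norm).log fun s hs => norm_ne_zero_iff.2 (hne s hs)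
  obtain ⟨R, hR⟩ := isCompact_Icc.exists_bound_of_continuousOn hc
  have hR0 : 0 ≤ R := (norm_nonneg _).trans (hR 0 (by simp))
  refine ⟨R + Real.pi, add_nonneg hR0 Real.pi_pos.le, fun s hs => ⟨hne s hs, ?_⟩⟩
  exact (norm_log_le_abs_log_add_pi _).trans (by gcongr; exact hR s hs)

lemma aemeasurable (hγ : IsLoopAroundOne γ) : AEMeasurable γ (volume.restrict (Set.Ioc 0 1)) :=
  (hγ.exists_smooth_off_countable.1.mono Set.Ioc_subset_Icc_self).aemeasurable measurableSet_Ioc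

/-- Near the ends ‖γ‖ is comparable to s(1 - s), so the integrand is dominated by a Beta(c, c)
integrand. The sum k^(c-1) + C^(c-1) handles both signs of c - 1. -/
lemma intervalIntegrable_cpow_mul_deriv (hγ : IsLoopAroundOne γ) {c : ℝ} (hc : 0 < c) :
    IntervalIntegrable (fun s => γ s ^ ((c : ℂ) - 1) * deriv γ s) volume 0 1 := by
  obtain ⟨-, S, hS, L, hL⟩ := hγ.exists_smooth_off_countable
  obtain ⟨k, hk, C, hb⟩ := hγ.exists_bounds
  have hC : 0 ≤ C := by
    have := (norm_nonneg _).trans (hb (1 / 2) (by norm_num)).2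
    norm_num at this
    linarith
  have hcre : 0 < (c : ℂ).re := by simpa
  have hbeta := (Complex.betaIntegral_convergent hcre hcre).norm.const_mul
    ((k ^ (c - 1) + C ^ (c - 1)) * L)
  rw [intervalIntegrable_iff, Set.uIoc_of_le zero_le_one] at hbeta ⊢
  have hm := hγ.aemeasurable
  have hmd := (measurable_deriv γ).aemeasurable (μ := volume.restrict (Set.Ioc 0 1))
  refine Integrable.mono' hbeta (by fun_prop : AEMeasurable _ _).aestronglyMeasurable ?_
  rw [ae_restrict_iff' measurableSet_Ioc]
  have h1 : ∀ᵐ s : ℝ, s ∉ S ∪ {1} := (hS.union (Set.countable_singleton 1)).ae_notMem volume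
  filter_upwards [h1] with s hs hsI
  rw [Set.mem_union, not_or] at hs
  have hs0 : 0 < s := hsI.1
  have hs1 : 0 < 1 - s := sub_pos.2 (lt_of_le_of_ne hsI.2 hs.2)
  obtain ⟨h2, h3⟩ := hb s ⟨hs0.le, hsI.2⟩
  have h4 := (hL s ⟨⟨hs0, by linarith⟩, hs.1⟩).2
  have hq : 0 < s * (1 - s) := mul_pos hs0 hs1
  have hlow : k * (s * (1 - s)) ≤ ‖γ s‖ := h2.trans (Complex.re_le_norm _)
  have e1 : ((c : ℂ) - 1) = ((c - 1 : ℝ) : ℂ) := by push_cast; rfl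
  have e2 : (1 - (s : ℂ)) = ((1 - s : ℝ) : ℂ) := by push_cast; rfl
  rw [norm_mul, norm_mul, e2, e1, Complex.norm_cpow_real, Complex.norm_cpow_real,
    Complex.norm_cpow_real, Complex.norm_real, Complex.norm_real, Real.norm_of_nonneg hs0.le,
    Real.norm_of_nonneg hs1.le, ← Real.mul_rpow hs0.le hs1.le]
  have hkey : ‖γ s‖ ^ (c - 1) ≤ (k ^ (c - 1) + C ^ (c - 1)) * (s * (1 - s)) ^ (c - 1) := by
    have hqc := Real.rpow_nonneg hq.le (c - 1)
    rw [add_mul]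
    rcases le_total 1 c with h | h
    · have := Real.rpow_le_rpow (norm_nonneg _) h3 (sub_nonneg.2 h)
      rw [Real.mul_rpow hC hq.le] at this
      linarith [mul_nonneg (Real.rpow_nonneg hk.le (c - 1)) hqc]
    · have := Real.rpow_le_rpow_of_nonpos (mul_pos hk hq) hlow (sub_nonpos.2 h)
      rw [Real.mul_rpow hk.le hq.le] at this
      linarith [mul_nonneg (Real.rpow_nonneg hC (c - 1)) hqc]
  calc ‖γ s‖ ^ (c - 1) * ‖deriv γ s‖
      ≤ ((k ^ (c - 1) + C ^ (c - 1)) * (s * (1 - s)) ^ (c - 1)) * L := by gcongr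
    _ = _ := by ring

lemma norm_cpow_le_exp_of_norm_log_le {M : ℝ} (z s : ℂ) (hz : z ≠ 0) (hM : ‖Complex.log z‖ ≤ M) :
    ‖z ^ s‖ ≤ Real.exp (M * ‖s‖) := by
  rw [Complex.cpow_def_of_ne_zero hz]
  refine (Complex.norm_exp_le_exp_norm _).trans (Real.exp_le_exp.2 ?_)
  rw [norm_mul]
  gcongr

lemma intervalIntegrable_kernel (hγ : IsLoopAroundOne γ) {c : ℝ} (hc : 0 < c) (s : ℂ) :
    IntervalIntegrable (fun τ => γ τ ^ ((c : ℂ) - 1) * deriv γ τ * (γ τ - 1) ^ s) volume 0 1 := by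
  obtain ⟨M, hM0, hM⟩ := hγ.exists_bound_log
  have h := hγ.intervalIntegrable_cpow_mul_deriv hc
  rw [intervalIntegrable_iff, Set.uIoc_of_le zero_le_one] at h ⊢
  have hm := hγ.aemeasurable
  refine Integrable.mul_bdd (c := Real.exp (M * ‖s‖)) h
    (by fun_prop : AEMeasurable _ _).aestronglyMeasurable ?_
  rw [ae_restrict_iff' measurableSet_Ioc]
  refine Eventually.of_forall fun τ hτ => ?_
  obtain ⟨h1, h2⟩ := hM τ (Set.Ioc_subset_Icc_self hτ)
  exact norm_cpow_le_exp_of_norm_log_le _ _ h1 h2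

/-- The Euler integral along a loop around `1`. -/
lemma integral_cpow_mul_kernel (hγ : IsLoopAroundOne γ) {a c : ℝ} (ha : 0 < a) (hc : 0 < c)
    (y : ℝ) :
    ∫ τ in (0 : ℝ)..1, (1 + Complex.I * γ τ * y) ^ (-(a : ℂ)) *
        (γ τ ^ ((c : ℂ) - 1) * deriv γ τ * (γ τ - 1) ^ ((a : ℂ) - c - 1)) =
      (1 + Complex.I * y) ^ (-(c : ℂ)) * ∫ τ in (0 : ℝ)..1,
        γ τ ^ ((c : ℂ) - 1) * deriv γ τ * (γ τ - 1) ^ ((a : ℂ) - c - 1) := by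
  obtain ⟨hcont, S, hS, L, hL⟩ := hγ.exists_smooth_off_countable
  obtain ⟨K, hK, hcone⟩ := hγ.exists_cone
  obtain ⟨M, hM0, hM⟩ := hγ.exists_bound_log
  have hc0 : (c : ℂ) ≠ 0 := by exact_mod_cast hc.ne'
  set A : ℝ → ℂ := fun τ => γ τ ^ (c : ℂ) * (γ τ - 1) ^ ((a : ℂ) - c) with hA
  -- The factor (γ - 1)^(a-c) sits on its branch cut at the ends and need not be continuous there,
  -- but it is bounded, and γ^c tends to 0 since c > 0.
  have hAend : ∀ e ∈ Set.Icc (0 : ℝ) 1, γ e = 0 → ContinuousWithinAt A (Set.Icc 0 1) e := by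
    intro e he h0
    have hAe : A e = 0 := by simp [hA, h0, hc0]
    rw [ContinuousWithinAt, hAe]
    have h1 : Tendsto (fun τ => ‖γ τ‖ ^ c * Real.exp (M * ‖(a : ℂ) - c‖)) (𝓝[Set.Icc 0 1] e)
        (𝓝 0) := by
      have := ((hcont e he).norm.rpow_const (p := c) (Or.inr hc.le)).mul_const
        (Real.exp (M * ‖(a : ℂ) - c‖))
      simpa [ContinuousWithinAt, h0, hc.ne'] using this
    refine squeeze_zero_norm' ?_ h1
    filter_upwards [self_mem_nhdsWithin] with τ hτ
    rw [hA, norm_mul, Complex.norm_cpow_real]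
    obtain ⟨h2, h3⟩ := hM τ hτ
    gcongr
    exact norm_cpow_le_exp_of_norm_log_le _ _ h2 h3
  refine integral_cpow_mul_eq_cpow_mul_integral (A := A) ha.le hK hcont hcone hS
    (fun s hs => (hL s hs).1) ?_ ?_ ?_ ?_ ?_ (hγ.intervalIntegrable_kernel hc _) y
  · intro s hs
    rcases hs.1.eq_or_lt with rfl | h0
    · exact hAend _ hs hγ.start
    rcases hs.2.eq_or_lt with rfl | h1
    · exact hAend _ hs hγ.finish
    · exact ((hcont s hs).cpow continuousWithinAt_const (hγ.mem_slitPlane ⟨h0, h1⟩)).mul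
        (((hcont s hs).sub continuousWithinAt_const).cpow continuousWithinAt_const
          (hγ.sub_one_mem_slitPlane ⟨h0, h1⟩))
  · simp [hA, hγ.start, hc0]
  · simp [hA, hγ.finish, hc0]
  · intro s hs
    have hs1 := hγ.mem_slitPlane hs.1
    have hs2 := hγ.sub_one_mem_slitPlane hs.1
    have hn1 := Complex.slitPlane_ne_zero hs1
    have hn2 := Complex.slitPlane_ne_zero hs2
    have h1 := hasDerivAt_cpow_const_of_real (c := (c : ℂ)) (hL s hs).1 hs1
    have h2 := hasDerivAt_cpow_const_of_real (c := (a : ℂ) - c) ((hL s hs).1.sub_const 1) hs2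
    refine (h1.mul h2).congr_deriv ?_
    rw [Complex.cpow_sub _ _ hn1, Complex.cpow_sub (x := γ s - 1) _ 1 hn2, Complex.cpow_one,
      Complex.cpow_one]
    field_simp
    ring
  · intro s hs
    have hn1 := Complex.slitPlane_ne_zero (hγ.mem_slitPlane hs.1)
    have hn2 := Complex.slitPlane_ne_zero (hγ.sub_one_mem_slitPlane hs.1)
    simp only [hA]
    rw [Complex.cpow_sub (x := γ s) _ _ hn1, Complex.cpow_sub (x := γ s - 1) _ 1 hn2, Complex.cpow_one,
      Complex.cpow_one]
    field_simp

end IsLoopAroundOne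

end

section

/-! ### The complete loop integral -/

/-- The integral `∫ u^(s-1) (1 + u (w - 1))^(c-1) du` over `[0, 1]`; times `(w - 1)^s` it is a
primitive of `w^(c-1) (w - 1)^(s-1)`. -/
noncomputable def segmentIntegral (s c : ℝ) (w : ℂ) : ℂ :=
  ∫ u in (0 : ℝ)..1, (u : ℂ) ^ ((s : ℂ) - 1) * (1 + u * (w - 1)) ^ ((c : ℂ) - 1)

lemma re_segment (u : ℝ) (w : ℂ) : (1 + (u : ℂ) * (w - 1)).re = 1 - u + u * w.re := by
  simp; ring

lemma segment_mem_slitPlane {u : ℝ} (hu : u ∈ Set.Icc (0 : ℝ) 1) {w : ℂ} (hw : 0 < w.re) :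
    1 + (u : ℂ) * (w - 1) ∈ Complex.slitPlane := by
  refine Or.inl ?_
  rw [re_segment]
  rcases hu.1.eq_or_lt with rfl | h
  · simp
  · have := mul_pos h hw
    linarith [hu.2]

lemma intervalIntegrable_cpow_sub_one {s : ℝ} (hs : 0 < s) :
    IntervalIntegrable (fun u : ℝ => (u : ℂ) ^ ((s : ℂ) - 1)) volume 0 1 :=
  intervalIntegral.intervalIntegrable_cpow' (by simpa)

/-- The left side of the relation integrates d/du [u^s (1 + u(w-1))^(c-1)] over [0, 1], leaving
w^(c-1). It is exactly what makes (w-1)^s times the segment integral a primitive. -/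
lemma hasDerivAt_segmentIntegral {s : ℝ} (hs : 0 < s) (c : ℝ) {w : ℂ} (hw : 0 < w.re) :
    ∃ H' : ℂ, HasDerivAt (segmentIntegral s c) H' w ∧
      s * segmentIntegral s c w + (w - 1) * H' = w ^ ((c : ℂ) - 1) := by
  have hI : Set.uIoc (0 : ℝ) 1 = Set.Ioc 0 1 := Set.uIoc_of_le zero_le_one
  have hsub : Set.Ioc (0 : ℝ) 1 ⊆ Set.Icc 0 1 := Set.Ioc_subset_Icc_self
  have hs0 : (s : ℂ) ≠ 0 := by exact_mod_cast hs.ne'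
  set F : ℂ → ℝ → ℂ := fun w u => (u : ℂ) ^ ((s : ℂ) - 1) * (1 + u * (w - 1)) ^ ((c : ℂ) - 1)
    with hF
  set F' : ℂ → ℝ → ℂ := fun w u => (u : ℂ) ^ ((s : ℂ) - 1) *
    (((c : ℂ) - 1) * (1 + u * (w - 1)) ^ ((c : ℂ) - 1 - 1) * u) with hF'
  have hcont : ∀ {w : ℂ}, 0 < w.re → ∀ e : ℂ, ContinuousOn
      (fun u : ℝ => (1 + (u : ℂ) * (w - 1)) ^ e) (Set.Icc 0 1) := fun hw e =>
    ContinuousOn.cpow (by fun_prop) continuousOn_const fun u hu => segment_mem_slitPlane hu hw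
  have hFi : IntervalIntegrable (F w) volume 0 1 :=
    (intervalIntegrable_cpow_sub_one hs).mul_continuousOn (by
      rw [Set.uIcc_of_le zero_le_one]; exact hcont hw _)
  set ρ := w.re / 2 with hρ
  have hρ0 : 0 < ρ := by positivity
  set δ := min 1 ρ with hδ
  have hδ0 : 0 < δ := lt_min one_pos hρ0
  set e := c - 1 - 1 with he
  have hder := intervalIntegral.hasDerivAt_integral_of_dominated_loc_of_deriv_le
    (F := F) (F' := F') (x₀ := w) (a := 0) (b := 1) (μ := volume)
    (bound := fun u => ‖(u : ℂ) ^ ((s : ℂ) - 1)‖ *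
      (|c - 1| * (δ ^ e + (2 + (‖w‖ + ρ)) ^ e)))
    (Metric.ball_mem_nhds w hρ0)
    (Eventually.of_forall fun w => (by fun_prop : Measurable _).aestronglyMeasurable) hFi
    (by fun_prop : Measurable _).aestronglyMeasurable
    (Eventually.of_forall fun u hu z hz => ?_)
    ((intervalIntegrable_cpow_sub_one hs).norm.mul_const _)
    (Eventually.of_forall fun u hu z hz => ?_)
  · refine ⟨_, hder.2, ?_⟩
    have h1 : ∀ u ∈ Set.Ioo (0 : ℝ) 1 \ ∅, HasDerivAt
        (fun u : ℝ => (u : ℂ) ^ (s : ℂ) * (1 + u * (w - 1)) ^ ((c : ℂ) - 1))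
        (s * F w u + (w - 1) * F' w u) u := by
      intro u hu
      have hu0 : (u : ℂ) ∈ Complex.slitPlane := Or.inl (by simpa using hu.1.1)
      have hu1 := segment_mem_slitPlane (Set.Ioo_subset_Icc_self hu.1) hw
      have h2 := hasDerivAt_cpow_const_of_real (c := (s : ℂ)) (hasDerivAt_id u).ofReal_comp hu0
      have h3 : HasDerivAt (fun u : ℝ => 1 + (u : ℂ) * (w - 1)) (w - 1) u := by
        simpa using ((hasDerivAt_id u).ofReal_comp.mul_const (w - 1)).const_add 1
      have h4 := hasDerivAt_cpow_const_of_real (c := (c : ℂ) - 1) h3 hu1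
      refine (h2.mul h4).congr_deriv ?_
      simp only [hF, hF']
      have hn0 := Complex.slitPlane_ne_zero hu0
      have hn1 := Complex.slitPlane_ne_zero hu1
      rw [Complex.cpow_sub (x := (u : ℂ)) _ 1 hn0, Complex.cpow_sub (x := 1 + (u : ℂ) * (w - 1)) ((c : ℂ) - 1) 1 hn1,
        Complex.cpow_one, Complex.cpow_one]
      simp only [id, Complex.ofReal_one]
      field_simp
    have h2 := integral_eq_of_hasDerivAt_off_countable_of_le _ _ zero_le_one Set.countable_empty
      ((ContinuousOn.mul (fun u _ => (Complex.continuousAt_ofReal_cpow_const u s (Or.inl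
        (by simpa))).continuousWithinAt) (hcont hw _))) h1
      ((hFi.const_mul _).add (hder.1.const_mul _))
    rw [intervalIntegral.integral_add (hFi.const_mul _) (hder.1.const_mul _),
      intervalIntegral.integral_const_mul, intervalIntegral.integral_const_mul] at h2
    rw [segmentIntegral, h2]
    simp [hs0]
  · rw [hI] at hu
    obtain ⟨h1, -⟩ := cone_of_mem_ball hw hz
    have hz0 : 0 < z.re := hρ0.trans h1
    have hn := Complex.slitPlane_ne_zero (segment_mem_slitPlane (hsub hu) hz0)
    have hlow : δ ≤ ‖1 + (u : ℂ) * (z - 1)‖ := by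
      refine le_trans ?_ (Complex.re_le_norm _)
      rw [re_segment]
      have h2 : δ ≤ 1 := min_le_left _ _
      have h3 : δ ≤ z.re := (min_le_right _ _).trans h1.le
      nlinarith [hu.1, hu.2]
    have hup : ‖1 + (u : ℂ) * (z - 1)‖ ≤ 2 + (‖w‖ + ρ) := by
      have h2 : ‖z‖ ≤ ‖w‖ + ρ := by
        have := norm_add_le w (z - w)
        rw [add_sub_cancel] at this
        rw [mem_ball_iff_norm] at hz
        linarith
      calc ‖1 + (u : ℂ) * (z - 1)‖ ≤ ‖(1 : ℂ)‖ + ‖(u : ℂ)‖ * (‖z‖ + ‖(1 : ℂ)‖) := by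
            refine (norm_add_le _ _).trans ?_
            rw [norm_mul]
            gcongr
            exact norm_sub_le _ _
        _ ≤ 1 + 1 * (‖z‖ + 1) := by
            rw [norm_one, Complex.norm_real, Real.norm_of_nonneg hu.1.le]
            gcongr
            exact hu.2
        _ ≤ _ := by linarith
    have hpow : ‖1 + (u : ℂ) * (z - 1)‖ ^ e ≤ δ ^ e + (2 + (‖w‖ + ρ)) ^ e := by
      have hM : 0 ≤ 2 + (‖w‖ + ρ) := by positivity
      rcases le_total 0 e with h | h
      · linarith [Real.rpow_le_rpow (norm_nonneg _) hup h, Real.rpow_nonneg hδ0.le e]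
      · linarith [Real.rpow_le_rpow_of_nonpos hδ0 hlow h, Real.rpow_nonneg hM e]
    have e1 : (c : ℂ) - 1 - 1 = ((e : ℝ) : ℂ) := by rw [he]; push_cast; rfl
    have e2 : (c : ℂ) - 1 = ((c - 1 : ℝ) : ℂ) := by push_cast; rfl
    simp only [hF', norm_mul]
    rw [e1, Complex.norm_cpow_real, e2, Complex.norm_real, Real.norm_eq_abs, Complex.norm_real,
      Real.norm_of_nonneg hu.1.le]
    refine mul_le_mul_of_nonneg_left ?_ (norm_nonneg _)
    calc |c - 1| * ‖1 + (u : ℂ) * (z - 1)‖ ^ e * u ≤ |c - 1| * ‖1 + (u : ℂ) * (z - 1)‖ ^ e * 1 := by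
          gcongr; exact hu.2
      _ ≤ _ := by rw [mul_one]; gcongr
  · rw [hI] at hu
    obtain ⟨h1, -⟩ := cone_of_mem_ball hw hz
    have h2 : HasDerivAt (fun z : ℂ => 1 + (u : ℂ) * (z - 1)) u z := by
      simpa using (((hasDerivAt_id z).sub_const 1).const_mul (u : ℂ)).const_add 1
    exact (h2.cpow_const (segment_mem_slitPlane (hsub hu) (hρ0.trans h1))).const_mul _

/-- At w = 0 the integrand becomes the beta integrand. For c < 1 the approach through Re w > 0 is
what supplies a dominating function, via ‖1 + u(w-1)‖ ≥ 1 - u. -/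
lemma tendsto_segmentIntegral {s c : ℝ} (hs : 0 < s) (hc : 0 < c) :
    Tendsto (segmentIntegral s c) (𝓝[{w | 0 < w.re}] 0) (𝓝 (Complex.betaIntegral s c)) := by
  have hI : Set.uIoc (0 : ℝ) 1 = Set.Ioc 0 1 := Set.uIoc_of_le zero_le_one
  have hsre : 0 < (s : ℂ).re := by simpa
  have hcre : 0 < (c : ℂ).re := by simpa
  have h1 : ∀ᵐ u : ℝ, u ≠ 1 := Measure.ae_ne volume 1
  refine intervalIntegral.tendsto_integral_filter_of_dominated_convergence
    (fun u => ‖(u : ℂ) ^ ((s : ℂ) - 1) * (1 - (u : ℂ)) ^ ((c : ℂ) - 1)‖ +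
      ‖(u : ℂ) ^ ((s : ℂ) - 1)‖ * 2 ^ (c - 1))
    (Eventually.of_forall fun w => (by fun_prop : Measurable _).aestronglyMeasurable) ?_
    ((Complex.betaIntegral_convergent hsre hcre).norm.add
      ((intervalIntegrable_cpow_sub_one hs).norm.mul_const _)) ?_
  · have hball : ∀ᶠ w : ℂ in 𝓝[{w | 0 < w.re}] 0, ‖w‖ < 1 :=
      nhdsWithin_le_nhds (by
        filter_upwards [Metric.ball_mem_nhds (0 : ℂ) one_pos] with w hw
        simpa using hw)
    filter_upwards [hball, self_mem_nhdsWithin] with w hw hwre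
    filter_upwards [h1] with u hu1 hu
    rw [hI] at hu
    have hu0 : 0 < u := hu.1
    have hu2 : 0 < 1 - u := sub_pos.2 (lt_of_le_of_ne hu.2 hu1)
    have hwre : 0 < w.re := hwre
    have e2 : (c : ℂ) - 1 = ((c - 1 : ℝ) : ℂ) := by push_cast; rfl
    have e3 : 1 - (u : ℂ) = ((1 - u : ℝ) : ℂ) := by push_cast; rfl
    rw [norm_mul, norm_mul, e2, Complex.norm_cpow_real, Complex.norm_cpow_real, e3,
      Complex.norm_real, Real.norm_of_nonneg hu2.le, ← mul_add]
    gcongr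
    rcases le_total 1 c with h | h
    · have hup : ‖1 + (u : ℂ) * (w - 1)‖ ≤ 2 := by
        calc ‖1 + (u : ℂ) * (w - 1)‖ = ‖((1 - u : ℝ) : ℂ) + u * w‖ := by
              congr 1; push_cast; ring
          _ ≤ ‖((1 - u : ℝ) : ℂ)‖ + ‖(u : ℂ) * w‖ := norm_add_le _ _
          _ = (1 - u) + u * ‖w‖ := by
              rw [norm_mul, Complex.norm_real, Complex.norm_real, Real.norm_of_nonneg hu2.le,
                Real.norm_of_nonneg hu0.le]
          _ ≤ 2 := by nlinarith [norm_nonneg w]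
      linarith [Real.rpow_le_rpow (norm_nonneg _) hup (sub_nonneg.2 h),
        Real.rpow_nonneg hu2.le (c - 1)]
    · have hlow : 1 - u ≤ ‖1 + (u : ℂ) * (w - 1)‖ := by
        refine le_trans ?_ (Complex.re_le_norm _)
        rw [re_segment]
        linarith [mul_pos hu0 hwre]
      linarith [Real.rpow_le_rpow_of_nonpos hu2 hlow (sub_nonpos.2 h),
        Real.rpow_nonneg (zero_le_two (α := ℝ)) (c - 1)]
  · filter_upwards [h1] with u hu1 hu
    rw [hI] at hu
    have hu2 : 0 < 1 - u := sub_pos.2 (lt_of_le_of_ne hu.2 hu1)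
    have hsl : 1 + (u : ℂ) * (0 - 1) ∈ Complex.slitPlane :=
      Or.inl (by rw [re_segment]; simpa using hu2)
    have h2 : ContinuousAt (fun w : ℂ => (u : ℂ) ^ ((s : ℂ) - 1) *
        (1 + (u : ℂ) * (w - 1)) ^ ((c : ℂ) - 1)) 0 :=
      continuousAt_const.mul (ContinuousAt.cpow (by fun_prop) continuousAt_const hsl)
    have h3 := h2.tendsto.mono_left (nhdsWithin_le_nhds (s := {w : ℂ | 0 < w.re}))
    convert h3 using 3
    ring_nf

namespace IsLoopAroundOne

variable {γ : ℝ → ℂ}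

/-- The primitive Φ has the same beta factor at both ends; only the branch of (γ - 1)^s differs,
with argument -π at the start and π at the finish. -/
lemma integral_kernel_of_pos (hγ : IsLoopAroundOne γ) {s c : ℝ} (hs : 0 < s) (hc : 0 < c) :
    ∫ τ in (0 : ℝ)..1, γ τ ^ ((c : ℂ) - 1) * deriv γ τ * (γ τ - 1) ^ ((s : ℂ) - 1) =
      (Complex.exp (Real.pi * Complex.I * s) - Complex.exp (-(Real.pi * Complex.I) * s)) *
        Complex.betaIntegral s c := by
  obtain ⟨hcont, S, hS, L, hL⟩ := hγ.exists_smooth_off_countable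
  set Φ : ℝ → ℂ := fun τ => (γ τ - 1) ^ (s : ℂ) * segmentIntegral s c (γ τ) with hΦ
  have hΦd : ∀ τ ∈ Set.Ioo (0 : ℝ) 1, ContinuousAt Φ τ := by
    intro τ hτ
    have hc' := hcont.continuousAt (Icc_mem_nhds hτ.1 hτ.2)
    obtain ⟨H', h1, -⟩ := hasDerivAt_segmentIntegral hs c (hγ.mem_slit τ hτ).1
    exact ((hc'.sub continuousAt_const).cpow continuousAt_const (hγ.sub_one_mem_slitPlane hτ)).mul
      (ContinuousAt.comp (g := segmentIntegral s c) h1.continuousAt hc')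
  have hre : ∀ {l : Filter ℝ} {e : ℝ}, l ≤ 𝓝[Set.Icc 0 1] e → (∀ᶠ τ in l, τ ∈ Set.Ioo (0 : ℝ) 1) →
      e ∈ Set.Icc (0 : ℝ) 1 → γ e = 0 →
      Tendsto (fun τ => segmentIntegral s c (γ τ)) l (𝓝 (Complex.betaIntegral s c)) := by
    intro l e hl hτ he h0
    refine (tendsto_segmentIntegral hs hc).comp (tendsto_nhdsWithin_iff.2 ⟨?_, ?_⟩)
    · rw [← h0]
      exact (hcont e he).tendsto.mono_left hl
    · filter_upwards [hτ] with τ hτ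
      exact (hγ.mem_slit τ hτ).1
  have hpow : ∀ {l : Filter ℝ} {v : ℂ}, (∀ᶠ τ in l, τ ∈ Set.Ioo (0 : ℝ) 1) →
      Tendsto (fun τ => Complex.log (γ τ - 1)) l (𝓝 v) →
      Tendsto (fun τ => (γ τ - 1) ^ (s : ℂ)) l (𝓝 (Complex.exp (v * s))) := by
    intro l v hτ hv
    refine ((Complex.continuous_exp.tendsto _).comp (hv.mul_const (s : ℂ))).congr' ?_
    filter_upwards [hτ] with τ hτ
    exact (Complex.cpow_def_of_ne_zero
      (Complex.slitPlane_ne_zero (hγ.sub_one_mem_slitPlane hτ)) _).symm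
  have hIoo0 : Set.Ioo (0 : ℝ) 1 ∈ 𝓝[>] (0 : ℝ) := Ioo_mem_nhdsGT one_pos
  have hIoo1 : Set.Ioo (0 : ℝ) 1 ∈ 𝓝[<] (1 : ℝ) := Ioo_mem_nhdsLT one_pos
  have hle0 : 𝓝[>] (0 : ℝ) ≤ 𝓝[Set.Icc 0 1] 0 := by
    rw [← nhdsWithin_Ioo_eq_nhdsGT one_pos]
    exact nhdsWithin_mono _ Set.Ioo_subset_Icc_self
  have hle1 : 𝓝[<] (1 : ℝ) ≤ 𝓝[Set.Icc 0 1] 1 := by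
    rw [← nhdsWithin_Ioo_eq_nhdsLT one_pos]
    exact nhdsWithin_mono _ Set.Ioo_subset_Icc_self
  have hsub0 : Tendsto (fun τ => γ τ - 1) (𝓝[>] 0) (𝓝 (-1)) := by
    have := ((hcont 0 (by simp)).tendsto.mono_left hle0).sub_const 1
    simpa [hγ.start] using this
  have hsub1 : Tendsto (fun τ => γ τ - 1) (𝓝[<] 1) (𝓝 (-1)) := by
    have := ((hcont 1 (by simp)).tendsto.mono_left hle1).sub_const 1
    simpa [hγ.finish] using this
  have hlog0 : Tendsto (fun τ => Complex.log (γ τ - 1)) (𝓝[>] 0) (𝓝 (-(Real.pi * Complex.I))) := by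
    have h1 := Complex.tendsto_log_nhdsWithin_im_neg_of_re_neg_of_im_zero (z := -1) (by simp)
      (by simp)
    simp only [norm_neg, norm_one, Real.log_one, Complex.ofReal_zero, zero_sub] at h1
    refine h1.comp (tendsto_nhdsWithin_iff.2 ⟨hsub0, ?_⟩)
    filter_upwards [hγ.starts_below] with τ hτ
    simpa using hτ
  -- The principal logarithm is continuous at -1 from above, whereas from below its limit is -πi.
  have hlog1 : Tendsto (fun τ => Complex.log (γ τ - 1)) (𝓝[<] 1) (𝓝 (Real.pi * Complex.I)) := by
    have h1 := (Complex.continuousWithinAt_log_of_re_neg_of_im_zero (z := -1) (by simp)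
      (by simp)).tendsto
    rw [Complex.log_neg_one] at h1
    refine h1.comp (tendsto_nhdsWithin_iff.2 ⟨hsub1, ?_⟩)
    filter_upwards [hγ.ends_above] with τ hτ
    simpa using hτ.le
  have hlim0 : Tendsto Φ (𝓝[>] 0) (𝓝 (Complex.exp (-(Real.pi * Complex.I) * s) *
      Complex.betaIntegral s c)) :=
    (hpow hIoo0 hlog0).mul (hre hle0 hIoo0 (by simp) hγ.start)
  have hlim1 : Tendsto Φ (𝓝[<] 1) (𝓝 (Complex.exp (Real.pi * Complex.I * s) *
      Complex.betaIntegral s c)) :=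
    (hpow hIoo1 hlog1).mul (hre hle1 hIoo1 (by simp) hγ.finish)
  have hΦc : ContinuousOn Φ (Set.Ioo 0 1) := fun τ hτ => (hΦd τ hτ).continuousWithinAt
  -- The value of Φ at the start uses the upper branch, not the limit from below, so Φ is replaced
  -- by its continuous extension from the open interval.
  have hext := integral_eq_of_hasDerivAt_off_countable_of_le (extendFrom (Set.Ioo 0 1) Φ)
    (fun τ => γ τ ^ ((c : ℂ) - 1) * deriv γ τ * (γ τ - 1) ^ ((s : ℂ) - 1)) zero_le_one hS
    (continuousOn_Icc_extendFrom_Ioo hΦc hlim0 hlim1) (fun τ hτ => ?_)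
    (hγ.intervalIntegrable_kernel hc _)
  · rw [hext, eq_lim_at_left_extendFrom_Ioo one_pos hlim0,
      eq_lim_at_right_extendFrom_Ioo one_pos hlim1, sub_mul]
  · have heq : extendFrom (Set.Ioo 0 1) Φ =ᶠ[𝓝 τ] Φ := by
      filter_upwards [Ioo_mem_nhds hτ.1.1 hτ.1.2] with x hx
      refine extendFrom_eq ?_ ((hΦd x hx).tendsto.mono_left nhdsWithin_le_nhds)
      rw [closure_Ioo zero_ne_one]
      exact Set.Ioo_subset_Icc_self hx
    refine HasDerivAt.congr_of_eventuallyEq ?_ heq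
    obtain ⟨H', h1, h2⟩ := hasDerivAt_segmentIntegral hs c (hγ.mem_slit τ hτ.1).1
    have hsl := hγ.sub_one_mem_slitPlane hτ.1
    have hn := Complex.slitPlane_ne_zero hsl
    have h3 := hasDerivAt_cpow_const_of_real (c := (s : ℂ)) ((hL τ hτ).1.sub_const 1) hsl
    refine (h3.mul (h1.scomp τ (hL τ hτ).1)).congr_deriv ?_
    rw [← h2, Complex.cpow_sub (x := γ τ - 1) _ 1 hn, Complex.cpow_one, smul_eq_mul]
    simp only [Function.comp]
    field_simp

/-- The logarithm of γ - 1 is bounded along the loop, so differentiation in s is dominated locally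
and the integral is entire in s. -/
lemma differentiable_integral_kernel (hγ : IsLoopAroundOne γ) {c : ℝ} (hc : 0 < c) :
    Differentiable ℂ fun s : ℂ =>
      ∫ τ in (0 : ℝ)..1, γ τ ^ ((c : ℂ) - 1) * deriv γ τ * (γ τ - 1) ^ (s - 1) := by
  intro s₀
  obtain ⟨M, hM0, hM⟩ := hγ.exists_bound_log
  have hI : Set.uIoc (0 : ℝ) 1 = Set.Ioc 0 1 := Set.uIoc_of_le zero_le_one
  have hm := hγ.aemeasurable
  rw [← hI] at hm
  have hmd := (measurable_deriv γ).aemeasurable (μ := volume.restrict (Set.uIoc 0 1))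
  refine (intervalIntegral.hasDerivAt_integral_of_dominated_loc_of_deriv_le
    (F := fun s τ => γ τ ^ ((c : ℂ) - 1) * deriv γ τ * (γ τ - 1) ^ (s - 1))
    (F' := fun s τ => γ τ ^ ((c : ℂ) - 1) * deriv γ τ *
      ((γ τ - 1) ^ (s - 1) * Complex.log (γ τ - 1))) (x₀ := s₀)
    (bound := fun τ => ‖γ τ ^ ((c : ℂ) - 1) * deriv γ τ‖ * (Real.exp (M * (‖s₀‖ + 1 + 1)) * M))
    (Metric.ball_mem_nhds s₀ one_pos)
    (Eventually.of_forall fun s => (by fun_prop : AEMeasurable _ _).aestronglyMeasurable)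
    (hγ.intervalIntegrable_kernel hc _) (by fun_prop : AEMeasurable _ _).aestronglyMeasurable
    (Eventually.of_forall fun τ hτ s hs => ?_)
    ((hγ.intervalIntegrable_cpow_mul_deriv hc).norm.mul_const _)
    (Eventually.of_forall fun τ hτ s hs => ?_)).2.differentiableAt
  · rw [hI] at hτ
    obtain ⟨h1, h2⟩ := hM τ (Set.Ioc_subset_Icc_self hτ)
    rw [norm_mul, norm_mul ((γ τ - 1) ^ (s - 1))]
    gcongr
    refine (norm_cpow_le_exp_of_norm_log_le _ _ h1 h2).trans (Real.exp_le_exp.2 ?_)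
    gcongr
    refine (norm_sub_le _ _).trans ?_
    rw [norm_one]
    gcongr
    have := norm_add_le s₀ (s - s₀)
    rw [add_sub_cancel] at this
    rw [mem_ball_iff_norm] at hs
    linarith
  · rw [hI] at hτ
    obtain ⟨h1, -⟩ := hM τ (Set.Ioc_subset_Icc_self hτ)
    have := ((hasDerivAt_id s).sub_const 1).const_cpow (c := γ τ - 1) (Or.inl h1)
    simpa using this.const_mul (γ τ ^ ((c : ℂ) - 1) * deriv γ τ)

/-- Evaluation of the loop integral of `w^(c-1) (w-1)^(s-1)`, for every `s`. -/
lemma integral_kernel (hγ : IsLoopAroundOne γ) {c : ℝ} (hc : 0 < c) (s : ℂ) :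
    ∫ τ in (0 : ℝ)..1, γ τ ^ ((c : ℂ) - 1) * deriv γ τ * (γ τ - 1) ^ (s - 1) =
      2 * Real.pi * Complex.I * Complex.Gamma c *
        ((Complex.Gamma (1 - s))⁻¹ * (Complex.Gamma (c + s))⁻¹) := by
  have hg : Differentiable ℂ fun s : ℂ => 2 * Real.pi * Complex.I * Complex.Gamma c *
      ((Complex.Gamma (1 - s))⁻¹ * (Complex.Gamma (c + s))⁻¹) :=
    (((Complex.differentiable_one_div_Gamma.comp ((differentiable_const (1 : ℂ)).sub
      differentiable_id)).mul (Complex.differentiable_one_div_Gamma.comp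
        ((differentiable_const (c : ℂ)).add differentiable_id)))).const_mul _
  refine congrFun (AnalyticOnNhd.eq_of_frequently_eq (z₀ := ((1 / 2 : ℝ) : ℂ))
    ((hγ.differentiable_integral_kernel hc).differentiableOn.analyticOnNhd isOpen_univ)
    (hg.differentiableOn.analyticOnNhd isOpen_univ) (frequently_eq_of_eventually_ofReal ?_)) s
  -- On 0 < s < 1 the primitive is available and sin(πs) ≠ 0, so the reflection formula converts the
  -- sine into 1 / (Γ(s) Γ(1-s)).
  filter_upwards [Ioo_mem_nhds (a := (0 : ℝ)) (b := 1) (by norm_num) (by norm_num)] with s hs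
  have hsre : 0 < (s : ℂ).re := by simpa using hs.1
  have hcre : 0 < (c : ℂ).re := by simpa
  rw [hγ.integral_kernel_of_pos hs.1 hc, Complex.betaIntegral_eq_Gamma_mul_div _ _ hsre hcre]
  have h1 : Complex.Gamma (1 - s) ≠ 0 :=
    Complex.Gamma_ne_zero_of_re_pos (by simpa using hs.2)
  have h2 : Complex.Gamma (c + s) ≠ 0 := Complex.Gamma_ne_zero_of_re_pos (by simp; linarith [hs.1])
  have h3 := Complex.Gamma_mul_Gamma_one_sub (s : ℂ)
  have h4 : Complex.sin (Real.pi * s) ≠ 0 := by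
    rw [← Complex.ofReal_mul, ← Complex.ofReal_sin]
    exact_mod_cast (Real.sin_pos_of_pos_of_lt_pi (mul_pos Real.pi_pos hs.1)
      (by nlinarith [Real.pi_pos, hs.2])).ne'
  have h5 : Complex.exp (Real.pi * Complex.I * s) - Complex.exp (-(Real.pi * Complex.I) * s) =
      2 * Complex.I * Complex.sin (Real.pi * s) := by
    rw [Complex.sin]
    have e1 : (Real.pi * Complex.I * s : ℂ) = Real.pi * s * Complex.I := by ring
    have e2 : (-(Real.pi * Complex.I) * s : ℂ) = -(Real.pi * s) * Complex.I := by ring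
    rw [e1, e2]
    ring_nf
    rw [Complex.I_sq]
    ring
  rw [h5, add_comm (s : ℂ)]
  rw [eq_div_iff h4] at h3
  field_simp
  linear_combination (Complex.Gamma c) * h3

end IsLoopAroundOne

end

/-! ### The case c > a: loop integrals -/

/-- The transform of order `c > a` of the mean of a Dirichlet process is a loop integral. -/
lemma IsDirichletProcess.integral_cpow_meanLaw_of_lt {a c : ℝ} {α : Measure ℝ}
    {D : Measure (ProbabilityMeasure ℝ)} (ha : 0 < a) (hα : α ∈ massClass a)
    (hD : IsDirichletProcess α D) (hc : 0 < c) (hca : a < c) (t : ℝ) {γ : ℝ → ℂ}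
    (hγ : IsLoopAroundOne γ) :
    IntervalIntegrable (pullback (loopIntegrand a c t α) γ) volume 0 1 ∧
      ∫ x, (1 + Complex.I * t * x) ^ (-(c : ℂ)) ∂(meanLaw D) =
        (Real.Gamma (c - a + 1) * Real.Gamma a : ℝ) /
            (2 * Real.pi * Complex.I * (Real.Gamma c : ℂ)) *
          contourIntegral (loopIntegrand a c t α) γ := by
  have hpr := hD.isProbabilityMeasure_meanLaw
  obtain ⟨K, hK, hcone⟩ := hγ.exists_cone
  set B : ℝ → ℂ := fun τ => γ τ ^ ((c : ℂ) - 1) * deriv γ τ * (γ τ - 1) ^ ((a : ℂ) - c - 1) with hB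
  have hBint : IntegrableOn B (Set.Ioc 0 1) :=
    (intervalIntegrable_iff_integrableOn_Ioc_of_le zero_le_one).1
      (hγ.intervalIntegrable_kernel hc _)
  set G : ℝ × ℝ → ℂ := fun q => (1 + Complex.I * γ q.1 * (t * q.2 : ℝ)) ^ (-(a : ℂ)) * B q.1 with hG
  have hGint : Integrable G ((volume.restrict (Set.Ioc 0 1)).prod (meanLaw D)) := by
    have h1 : AEMeasurable (fun q : ℝ × ℝ => γ q.1)
        ((volume.restrict (Set.Ioc 0 1)).prod (meanLaw D)) :=
      hγ.aemeasurable.comp_quasiMeasurePreserving Measure.quasiMeasurePreserving_fst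
    have h3 : AEMeasurable (fun q : ℝ × ℝ => ((t * q.2 : ℝ) : ℂ))
        ((volume.restrict (Set.Ioc 0 1)).prod (meanLaw D)) :=
      (by fun_prop : Measurable fun q : ℝ × ℝ => ((t * q.2 : ℝ) : ℂ)).aemeasurable
    refine Integrable.bdd_mul (c := (1 + K) ^ a) (hBint.comp_fst (meanLaw D))
      ((((h1.const_mul Complex.I).mul h3).const_add 1).pow_const _).aestronglyMeasurable ?_
    have h2 : ∀ᵐ τ ∂(volume.restrict (Set.Ioc (0 : ℝ) 1)), τ ∈ Set.Ioc (0 : ℝ) 1 :=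
      ae_restrict_mem measurableSet_Ioc
    filter_upwards [Measure.quasiMeasurePreserving_fst.ae h2] with q hq
    exact norm_cpow_neg_le_of_cone ha.le hK (hcone _ (Set.Ioc_subset_Icc_self hq)) _
  have hpull : ∀ᵐ τ ∂(volume.restrict (Set.Ioc (0 : ℝ) 1)),
      ∫ x, G (τ, x) ∂(meanLaw D) = pullback (loopIntegrand a c t α) γ τ := by
    -- At τ = 1 the loop is back at 0, outside the half-plane where the Markov–Krein identity was
    -- continued.
    have h1 : ∀ᵐ τ : ℝ, τ ≠ 1 := Measure.ae_ne volume 1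
    rw [ae_restrict_iff' measurableSet_Ioc]
    filter_upwards [h1] with τ hτ1 hτ
    have hre := (hγ.mem_slit τ ⟨hτ.1, lt_of_le_of_ne hτ.2 hτ1⟩).1
    simp only [hG]
    rw [integral_mul_const, hD.integral_cpow_meanLaw ha hα t hre]
    simp only [pullback, loopIntegrand, hB]
    ring
  refine ⟨(intervalIntegrable_iff_integrableOn_Ioc_of_le zero_le_one).2
    (hGint.integral_prod_left.congr hpull), ?_⟩
  -- The loop evaluation at s = a - c, where 1 - s = c - a + 1 and c + s = a.
  have hJ : ∫ τ in (0 : ℝ)..1, B τ = 2 * Real.pi * Complex.I * (Real.Gamma c : ℂ) /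
      (Real.Gamma (c - a + 1) * Real.Gamma a : ℝ) := by
    rw [hB, hγ.integral_kernel hc]
    have e1 : (1 : ℂ) - (a - c) = ((c - a + 1 : ℝ) : ℂ) := by push_cast; ring
    have e2 : (c : ℂ) + (a - c) = a := by ring
    rw [e1, e2, Complex.Gamma_ofReal, Complex.Gamma_ofReal, Complex.Gamma_ofReal]
    push_cast
    rw [div_eq_mul_inv, mul_inv]
  have hΓ : ((Real.Gamma (c - a + 1) * Real.Gamma a : ℝ) : ℂ) ≠ 0 := by
    exact_mod_cast (mul_pos (Real.Gamma_pos_of_pos (by linarith)) (Real.Gamma_pos_of_pos ha)).ne'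
  have hΓc : (Real.Gamma c : ℂ) ≠ 0 := by exact_mod_cast (Real.Gamma_pos_of_pos hc).ne'
  have hpi : (Real.pi : ℂ) ≠ 0 := by exact_mod_cast Real.pi_ne_zero
  have hx : ∀ x : ℝ, ∫ τ in Set.Ioc (0 : ℝ) 1, G (τ, x) =
      (1 + Complex.I * t * x) ^ (-(c : ℂ)) * ∫ τ in (0 : ℝ)..1, B τ := fun x => by
    have := hγ.integral_cpow_mul_kernel ha hc (t * x)
    rw [intervalIntegral.integral_of_le zero_le_one] at this
    simp only [hG]
    rw [this]
    push_cast
    rw [mul_assoc Complex.I]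
  rw [contourIntegral, intervalIntegral.integral_of_le zero_le_one, ← integral_congr_ae hpull,
    integral_integral_swap (f := fun τ x => G (τ, x)) hGint, integral_congr_ae
    (Eventually.of_forall hx), integral_mul_const, hJ]
  field_simp

end LauricellaIdentity

theorem theorem4 (a : ℝ) (ha : 0 < a) (α : Measure ℝ)
    (hα : α ∈ LauricellaIdentity.massClass a)
    (D : Measure (ProbabilityMeasure ℝ)) (hD : LauricellaIdentity.IsDirichletProcess α D)
    (c : ℝ) (hc : 0 < c) (t : ℝ) :
    (c ≤ a →
      ∫ x, (1 + Complex.I * t * x) ^ (-(c : ℂ)) ∂(LauricellaIdentity.meanLaw D) =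
        ∫ u in Set.Icc (0 : ℝ) 1,
          Complex.exp (-LauricellaIdentity.zeta (Complex.I * u * t) α id)
            ∂(LauricellaIdentity.betaLaw c (a - c))) ∧
    (a < c → ∀ γ : ℝ → ℂ, LauricellaIdentity.IsLoopAroundOne γ →
      IntervalIntegrable
        (LauricellaIdentity.pullback (LauricellaIdentity.loopIntegrand a c t α) γ) volume 0 1 ∧
      ∫ x, (1 + Complex.I * t * x) ^ (-(c : ℂ)) ∂(LauricellaIdentity.meanLaw D) =
        (Real.Gamma (c - a + 1) * Real.Gamma a : ℝ) /
            (2 * Real.pi * Complex.I * (Real.Gamma c : ℂ)) *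
          LauricellaIdentity.contourIntegral
            (LauricellaIdentity.loopIntegrand a c t α) γ) :=
  ⟨fun hca => hD.integral_cpow_meanLaw_of_le ha hα hc hca t,
    fun hca _ hγ => hD.integral_cpow_meanLaw_of_lt ha hα hc hca t hγ⟩
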